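/- **Setting.** Consider $N$ queues, a finite set $\mathcal S\subset\mathbb R_+^N$ of schedules, and a routing matrix $R\in\{0,1\}^{N\times N}$ in which each row has at most one entry $1$ ($R_{mn}=1$ means that work served at queue $m$ moves to queue $n$). Routing is acyclic: work served at a queue never returns to it. Put $\tilde R=(I-R^{\top})^{-1}$ and $\tilde x=\tilde R x$ for $x\in\mathbb R^N$. Vectors are compared componentwise and $|x|=\max_n|x_n|$. Assume that * $\mathcal S$ is monotone: if $\pi\in\mathcal S$ and $\rho_n\in\{0,\pi_n\}$ for all $n$, then $\rho\in\mathcal S$; * every queue is served by some schedule: for each $n$ there is $\pi\in\mathcal S$ with $\pi_n>0$; * $f:\mathbb R_+\to\mathbb R_+$ is continuous, differentiable on $(0,\infty)$, strictly increasing, $f(0)=0$, and, with $f$ applied componentwise, for all $q\in\mathbb R_+^N$ and $\pi\in\mathcal S$: if $\pi\cdot(I-R)f(q)=\max_{\rho\in\mathcal S}\rho\cdot(I-R)f(q)$, then $\pi\cdot(I-R)f(\kappa q)=\max_{\rho\in\mathcal S}\rho\cdot(I-R)f(\kappa q)$ for all $\kappa\ge0$; * $\lambda\in\mathbb R_+^N$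 satisfies $\tilde\lambda\in\Lambda$, where $\Lambda=\{x\in\mathbb R_+^N: x\le\sigma\text{ for some }\sigma\text{ in the convex hull of }\mathcal S\}$. **Lifting map.** Let $E$ be the set of extreme points of $\{\xi\in\mathbb R_+^N:\xi\cdot\pi\le1\text{ for all }\pi\in\mathcal S\}$, let $\mathcal S^*$ be the set of componentwise maximal elements of $E$, and let $\Xi=\{\xi\in\mathcal S^*:\xi\cdot\tilde\lambda=1\}$. Let $L(q)=\sum_n\int_0^{q_n}f(x)\,dx$ for $q\in\mathbb R_+^N$. For $q\in\mathbb R_+^N$, let $\mathcal W(q)$ be the optimizer of the problem: minimize $L(r)$ over $r\in\mathbb R_+^N$ such that $\xi\cdot\tilde r\ge\xi\cdot\tilde q$ for all $\xi\in\Xi$, and $\tilde r_n\le\tilde q_n$ for all $n$ with $\tilde\lambda_n=0$. **Fluid model solutions.** Let $0<T\le\infty$, and let the time set be $[0,T]$ if $T<\infty$ and $[0,\infty)$ if $T=\infty$. A fluid model solution with arrival rate $\lambda$ consists of functions $q,a,y$ from the time set to $\mathbb R_+^N$ and $s_\pi$ ($\pi\in\mathcal S$) from the time set to $\mathbb R_+$,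 all absolutely continuous on compact intervals, such that for all $t$ in the time set $$q(t)=q(0)+a(t)-(I-R^{\top})\Big(\sum_{\pi}s_\pi(t)\pi-y(t)\Big),\quad a(t)=\lambda t,\quad \sum_\pi s_\pi(t)=t,\quad y(t)\le\sum_\pi s_\pi(t)\pi,$$ each $s_\pi$ and each $y_n$ is nondecreasing, and at each $t\in(0,T)$ at which all components are differentiable, $\dot y_n(t)=0$ if $q_n(t)>0$, and $\dot s_\pi(t)=0$ if $\pi\cdot(I-R)f(q(t))<\max_{\rho\in\mathcal S}\rho\cdot(I-R)f(q(t))$. For given $T$, a state $q^0\in\mathbb R_+^N$ is *invariant* if every fluid model solution with $q(0)=q^0$ satisfies $q(t)=q^0$ for all $t$ in the time set. **Theorem 6.1 (portmanteau theorem, multi-hop version).** For every $q\in\mathbb R_+^N$ the optimizer $\mathcal W(q)$ exists and is unique, and the following hold. (i) For every $K\in\mathbb R$ the set $\{q\in\mathbb R_+^N:L(q)\le K\}$ is compact; and, for every $T\in(0,\infty]$, every fluid model solution satisfies $L(q(t))\le L(q(0))$ for all $t$ in the time set. (ii) $\mathcal W:\mathbb R_+^N\to\mathbb R_+^N$ is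 continuous. (iii) If $q\in\mathbb R_+^N$ and $q=\mathcal W(q)$, then $\mathcal W(\kappa q)=\kappa\,\mathcal W(q)$ for all $\kappa>0$. (iv) For every $T\in(0,\infty]$ and $q^0\in\mathbb R_+^N$: $q^0$ is an invariant state if and only if $q^0=\mathcal W(q^0)$. (v) For every $\varepsilon>0$ there is $H_\varepsilon<\infty$ such that for every $T\in(0,\infty]$ and every fluid model solution with $|q(0)|\le1$, $|q(t)-\mathcal W(q(t))|<\varepsilon$ for all $t\ge H_\varepsilon$ in the time set. -/

import Mathlib

open scoped Matrix

noncomputable section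

namespace SwitchedNetwork

variable {N : ℕ}

/-- `R` is a routing matrix with fixed acyclic routing: its entries are `0` or `1`, each queue
sends its served work to at most one queue, and work served from a queue never returns to it. -/
structure IsAcyclicRouting (R : Matrix (Fin N) (Fin N) ℝ) : Prop where
  zero_or_one : ∀ m n, R m n = 0 ∨ R m n = 1
  at_most_one : ∀ m n n', R m n = 1 → R m n' = 1 → n = n'
  acyclic : ∀ n, ¬ Relation.TransGen (fun m n' => R m n' = 1) n n

/-- For acyclic routing, `I - Rᵀ` is invertible, so that the inverse below is a true inverse. -/
theorem IsAcyclicRouting.isUnit_det {R : Matrix (Fin N) (Fin N) ℝ} (hR : IsAcyclicRouting R) :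
    IsUnit (1 - Rᵀ).det := by
  have h1 : (1 - Rᵀ) = (1 - R)ᵀ := by simp
  rw [h1, Matrix.det_transpose, isUnit_iff_ne_zero]
  intro h0
  obtain ⟨v, hv, hv0⟩ := Matrix.exists_mulVec_eq_zero_iff.mpr h0
  apply hv
  let r : Fin N → Fin N → Prop := fun a b => Relation.TransGen (fun m n' => R m n' = 1) b a
  have : Std.Irrefl r := ⟨fun a h => hR.acyclic a h⟩
  have : IsTrans (Fin N) r := ⟨fun a b c h1 h2 => Relation.TransGen.trans h2 h1⟩
  have wf : WellFounded r := Finite.wellFounded_of_trans_of_irrefl r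
  funext n
  induction n using wf.induction with
  | _ n ih =>
    have h2 := congrFun hv0 n
    rw [Matrix.sub_mulVec, Matrix.one_mulVec, Pi.sub_apply, Pi.zero_apply] at h2
    have h3 : (R *ᵥ v) n = 0 := by
      rw [Matrix.mulVec, dotProduct]
      refine Finset.sum_eq_zero fun m _ => ?_
      rcases hR.zero_or_one n m with h | h
      · simp [h]
      · have := ih m (Relation.TransGen.single h)
        simp [this]
    rw [h3, sub_zero] at h2
    simpa using h2

/-- `x ↦ R̃ x`, where `R̃ = (I - Rᵀ)⁻¹`. -/
def through (R : Matrix (Fin N) (Fin N) ℝ) (x : Fin N → ℝ) : Fin N → ℝ :=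
  (1 - Rᵀ)⁻¹ *ᵥ x

/-- The vector of backpressures `(I - R) f(q)`. -/
def pressure (R : Matrix (Fin N) (Fin N) ℝ) (f : ℝ → ℝ) (q : Fin N → ℝ) : Fin N → ℝ :=
  (1 - R) *ᵥ (fun n => f (q n))

/-- The assumption on the weight function `f : ℝ₊ → ℝ₊` of the backpressure policy. The function
is given on all of `ℝ`, but only its values on `[0, ∞)` matter. At the point `0` only continuity
is asked for, so that `f x = x ^ α` is included for every `α > 0`. -/
structure IsWeightFunction (S : Finset (Fin N → ℝ)) (R : Matrix (Fin N) (Fin N) ℝ)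
    (f : ℝ → ℝ) : Prop where
  continuousOn : ContinuousOn f (Set.Ici 0)
  differentiableOn : DifferentiableOn ℝ f (Set.Ioi 0)
  strictMonoOn : StrictMonoOn f (Set.Ici 0)
  map_zero : f 0 = 0
  scale : ∀ q : Fin N → ℝ, 0 ≤ q → ∀ π ∈ S,
    (∀ ρ ∈ S, ρ ⬝ᵥ pressure R f q ≤ π ⬝ᵥ pressure R f q) →
    ∀ κ : ℝ, 0 ≤ κ → ∀ ρ ∈ S, ρ ⬝ᵥ pressure R f (κ • q) ≤ π ⬝ᵥ pressure R f (κ • q)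

/-- The schedule set is monotone: from every schedule one may drop the service of any queues. -/
def IsMonotoneSchedules (S : Finset (Fin N → ℝ)) : Prop :=
  ∀ π ∈ S, ∀ ρ : Fin N → ℝ, (∀ n, ρ n = 0 ∨ ρ n = π n) → ρ ∈ S

/-- The admissible region `Λ`. -/
def admissibleRegion (S : Finset (Fin N → ℝ)) : Set (Fin N → ℝ) :=
  {l | 0 ≤ l ∧ ∃ σ ∈ convexHull ℝ (S : Set (Fin N → ℝ)), l ≤ σ}

/-- The feasible region of the dual static planning problem. -/
def dualFeasible (S : Finset (Fin N → ℝ)) : Set (Fin N → ℝ) :=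
  {ξ | 0 ≤ ξ ∧ ∀ π ∈ S, ξ ⬝ᵥ π ≤ 1}

/-- Virtual resources: the maximal extreme points of the dual feasible region. -/
def virtualResources (S : Finset (Fin N → ℝ)) : Set (Fin N → ℝ) :=
  {ξ | ξ ∈ (dualFeasible S).extremePoints ℝ ∧
    ∀ ζ ∈ (dualFeasible S).extremePoints ℝ, ξ ≤ ζ → ξ = ζ}

/-- The critically loaded virtual resources `Ξ(l)`. -/
def criticalResources (S : Finset (Fin N → ℝ)) (l : Fin N → ℝ) : Set (Fin N → ℝ) :=
  {ξ | ξ ∈ virtualResources S ∧ ξ ⬝ᵥ l = 1}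

/-- The Lyapunov function `L(q) = ∑ₙ F(qₙ)`, where `F(x) = ∫₀ˣ f`. -/
def lyapunov (f : ℝ → ℝ) (q : Fin N → ℝ) : ℝ :=
  ∑ n, ∫ x in (0 : ℝ)..(q n), f x

/-- `r` satisfies the constraints of the optimization problem `ALGD(q)` with arrival rates `l`. -/
structure IsFeasible (S : Finset (Fin N → ℝ)) (R : Matrix (Fin N) (Fin N) ℝ)
    (l q r : Fin N → ℝ) : Prop where
  nonneg : 0 ≤ r
  workload : ∀ ξ ∈ criticalResources S (through R l), ξ ⬝ᵥ through R q ≤ ξ ⬝ᵥ through R r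
  unloaded : ∀ n, through R l n = 0 → through R r n ≤ through R q n

/-- `r` is an optimizer of `ALGD(q)`: it minimizes `L` over all feasible points. -/
def IsOptimizer (S : Finset (Fin N → ℝ)) (R : Matrix (Fin N) (Fin N) ℝ) (f : ℝ → ℝ)
    (l q r : Fin N → ℝ) : Prop :=
  IsFeasible S R l q r ∧ ∀ r', IsFeasible S R l q r' → lyapunov f r ≤ lyapunov f r'

/-- The lifting map: it sends `q` to the optimizer of `ALGD(q)`. (Existence and uniqueness of the
optimizer for `q ≥ 0` are not presupposed here.) -/
def liftingMap (S : Finset (Fin N → ℝ)) (R : Matrix (Fin N) (Fin N) ℝ) (f : ℝ → ℝ)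
    (l q : Fin N → ℝ) : Fin N → ℝ :=
  Classical.epsilon (fun r => IsOptimizer S R f l q r)

/-- The time set: `[0, T]` for finite `T`, and `[0, ∞)` for `T = ⊤`. -/
def horizon (T : EReal) : Set ℝ := {t | 0 ≤ t ∧ (t : EReal) ≤ T}

/-- The components of a fluid path: queue sizes, arrivals, idling, and time on each schedule.
Only the values at times in the time set matter. -/
structure FluidPath (S : Finset (Fin N → ℝ)) where
  q : ℝ → Fin N → ℝ
  a : ℝ → Fin N → ℝ
  y : ℝ → Fin N → ℝ
  s : S → ℝ → ℝ

/-- All the components are differentiable at `t`. -/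
structure FluidPath.IsRegular {S : Finset (Fin N → ℝ)} (x : FluidPath S) (t : ℝ) : Prop where
  q : ∀ n, DifferentiableAt ℝ (fun u => x.q u n) t
  a : ∀ n, DifferentiableAt ℝ (fun u => x.a u n) t
  y : ∀ n, DifferentiableAt ℝ (fun u => x.y u n) t
  s : ∀ π, DifferentiableAt ℝ (x.s π) t

/-- The total service offered up to time `t`, the sum of `s_π(t) π` over all schedules. -/
def FluidPath.service {S : Finset (Fin N → ℝ)} (x : FluidPath S) (t : ℝ) : Fin N → ℝ :=
  ∑ π : S, x.s π t • (π : Fin N → ℝ)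

/-- Multi-hop fluid model solutions under backpressure, with arrival rates `l`, on the time set
`horizon T`. -/
structure IsFluidSolution (S : Finset (Fin N → ℝ)) (R : Matrix (Fin N) (Fin N) ℝ) (f : ℝ → ℝ)
    (l : Fin N → ℝ) (T : EReal) (x : FluidPath S) : Prop where
  q_nonneg : ∀ t ∈ horizon T, 0 ≤ x.q t
  a_nonneg : ∀ t ∈ horizon T, 0 ≤ x.a t
  y_nonneg : ∀ t ∈ horizon T, 0 ≤ x.y t
  s_nonneg : ∀ π, ∀ t ∈ horizon T, 0 ≤ x.s π t
  queue : ∀ t ∈ horizon T, x.q t = x.q 0 + x.a t - (1 - Rᵀ) *ᵥ (x.service t - x.y t)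
  arrivals : ∀ t ∈ horizon T, x.a t = t • l
  busy : ∀ t ∈ horizon T, ∑ π : S, x.s π t = t
  idle_le : ∀ t ∈ horizon T, x.y t ≤ x.service t
  s_mono : ∀ π, MonotoneOn (x.s π) (horizon T)
  y_mono : ∀ n, MonotoneOn (fun t => x.y t n) (horizon T)
  q_abs_cont : ∀ n, ∀ t ∈ horizon T, AbsolutelyContinuousOnInterval (fun u => x.q u n) 0 t
  a_abs_cont : ∀ n, ∀ t ∈ horizon T, AbsolutelyContinuousOnInterval (fun u => x.a u n) 0 t
  y_abs_cont : ∀ n, ∀ t ∈ horizon T, AbsolutelyContinuousOnInterval (fun u => x.y u n) 0 t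
  s_abs_cont : ∀ π, ∀ t ∈ horizon T, AbsolutelyContinuousOnInterval (x.s π) 0 t
  idling : ∀ t : ℝ, 0 < t → (t : EReal) < T → x.IsRegular t → ∀ n, 0 < x.q t n →
    deriv (fun u => x.y u n) t = 0
  max_weight : ∀ t : ℝ, 0 < t → (t : EReal) < T → x.IsRegular t → ∀ π : S,
    (∃ ρ ∈ S, (π : Fin N → ℝ) ⬝ᵥ pressure R f (x.q t) < ρ ⬝ᵥ pressure R f (x.q t)) →
    deriv (x.s π) t = 0

/-- `q₀` is an invariant state: every fluid model solution started at `q₀` stays there. -/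
def IsInvariantState (S : Finset (Fin N → ℝ)) (R : Matrix (Fin N) (Fin N) ℝ) (f : ℝ → ℝ)
    (l : Fin N → ℝ) (T : EReal) (q₀ : Fin N → ℝ) : Prop :=
  ∀ x : FluidPath S, IsFluidSolution S R f l T x → x.q 0 = q₀ → ∀ t ∈ horizon T, x.q t = q₀

end SwitchedNetwork

end

open SwitchedNetwork

noncomputable section

namespace SwitchedNetwork

variable {N : ℕ}

/-! The argument turns on one condition, `IsBalanced`: the offered work λ̃ has at least the weight
of every schedule under the pressure (I - R) f(q). Since f(q)·x = x̃·(I - R) f(q), passing to x̃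
puts the multi-hop problem in single-hop form.

Fixed points of the lifting map are exactly the balanced states. If q is balanced, the positive part
of the pressure, normalised by its maximal weight, is a dual feasible point that is tight at λ̃.
Such a point pairs nonnegatively with every feasible displacement
(`IsNetwork.dual_dotProduct_nonneg`), so convexity of L makes q optimal. Conversely, moving from q
along the drift produced by any schedule is feasible for a short time, and optimality makes that
direction non-decreasing for L. Balance survives scaling because λ̃ is a mixture of maximal
schedules only, which gives (iii).

Along a fluid solution, L falls at least as fast as the weight of the best schedule exceeds that of
λ̃, and every later state is feasible for the problem posed by an earlier one. So L(q(t)) decreases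
while L(W(q(t))) increases, and their difference (the excess) decreases. The excess vanishes only at
balanced states. On a compact sublevel set it is therefore bounded below away from them, and where
it is large L falls at a uniform rate. This gives (v), and uniqueness of the optimizer shows that
fixed points are invariant.

The other half of (iv) needs some solution to start at each state, as otherwise invariance would be
vacuous. An Euler scheme supplies one, and a constant solution must be balanced, since L would
otherwise drop. -/

/-- The standing assumptions on the network. -/
structure IsNetwork (S : Finset (Fin N → ℝ)) (R : Matrix (Fin N) (Fin N) ℝ)
    (f : ℝ → ℝ) (l : Fin N → ℝ) : Prop where
  sched_nonneg : ∀ π ∈ S, 0 ≤ π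
  served : ∀ n, ∃ π ∈ S, 0 < π n
  monotone : IsMonotoneSchedules S
  routing : IsAcyclicRouting R
  weight : IsWeightFunction S R f
  rate_nonneg : 0 ≤ l
  admissible : through R l ∈ admissibleRegion S

variable {S : Finset (Fin N → ℝ)} {R : Matrix (Fin N) (Fin N) ℝ} {f : ℝ → ℝ} {l : Fin N → ℝ}

/-! ### Linear algebra of the routing matrix -/

theorem IsAcyclicRouting.mulVec_through (hR : IsAcyclicRouting R) (x : Fin N → ℝ) :
    (1 - Rᵀ) *ᵥ through R x = x := by
  rw [through, Matrix.mulVec_mulVec, Matrix.mul_nonsing_inv _ hR.isUnit_det, Matrix.one_mulVec]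

theorem IsAcyclicRouting.through_mulVec (hR : IsAcyclicRouting R) (x : Fin N → ℝ) :
    through R ((1 - Rᵀ) *ᵥ x) = x := by
  rw [through, Matrix.mulVec_mulVec, Matrix.nonsing_inv_mul _ hR.isUnit_det, Matrix.one_mulVec]

theorem through_add (x y : Fin N → ℝ) : through R (x + y) = through R x + through R y :=
  Matrix.mulVec_add _ _ _

theorem through_sub (x y : Fin N → ℝ) : through R (x - y) = through R x - through R y :=
  Matrix.mulVec_sub _ _ _

theorem through_smul (c : ℝ) (x : Fin N → ℝ) : through R (c • x) = c • through R x :=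
  Matrix.mulVec_smul _ _ _

theorem continuous_through : Continuous (through R) :=
  Continuous.matrix_mulVec continuous_const continuous_id

theorem weights_dotProduct_mulVec (q x : Fin N → ℝ) :
    (fun n => f (q n)) ⬝ᵥ ((1 - Rᵀ) *ᵥ x) = x ⬝ᵥ pressure R f q := by
  have h : (1 - Rᵀ) = (1 - R)ᵀ := by simp
  rw [h, Matrix.dotProduct_mulVec, Matrix.vecMul_transpose, dotProduct_comm, pressure]

/-- The change of variables that turns first-order statements about L into statements about
schedules and pressures. -/
theorem IsAcyclicRouting.weights_dotProduct (hR : IsAcyclicRouting R) (q x : Fin N → ℝ) :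
    (fun n => f (q n)) ⬝ᵥ x = through R x ⬝ᵥ pressure R f q := by
  rw [← weights_dotProduct_mulVec, hR.mulVec_through]

theorem one_sub_transpose_mulVec_apply (x : Fin N → ℝ) (n : Fin N) :
    ((1 - Rᵀ) *ᵥ x) n = x n - ∑ m, R m n * x m := by
  rw [Matrix.sub_mulVec, Matrix.one_mulVec, Pi.sub_apply]
  rfl

theorem IsAcyclicRouting.entry_nonneg (hR : IsAcyclicRouting R) (m n : Fin N) : 0 ≤ R m n := by
  rcases hR.zero_or_one m n with h | h <;> simp [h]

/-- Induction along the routing, from the sources downstream. -/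
theorem IsAcyclicRouting.upstream_induction (hR : IsAcyclicRouting R) {P : Fin N → Prop}
    (h : ∀ n, (∀ m, R m n = 1 → P m) → P n) (n : Fin N) : P n := by
  let r : Fin N → Fin N → Prop := Relation.TransGen (fun m n' => R m n' = 1)
  have : Std.Irrefl r := ⟨fun a h => hR.acyclic a h⟩
  have : IsTrans (Fin N) r := ⟨fun a b c h1 h2 => Relation.TransGen.trans h1 h2⟩
  have wf : WellFounded r := Finite.wellFounded_of_trans_of_irrefl r
  induction n using wf.induction with
  | _ n ih => exact h n fun m hm => ih m (Relation.TransGen.single hm)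

theorem pressure_apply (q : Fin N → ℝ) (n : Fin N) :
    pressure R f q n = f (q n) - ∑ m, R n m * f (q m) := by
  rw [pressure, Matrix.sub_mulVec, Matrix.one_mulVec, Pi.sub_apply]
  rfl

theorem IsWeightFunction.nonneg (hf : IsWeightFunction S R f) {x : ℝ} (hx : 0 ≤ x) : 0 ≤ f x := by
  rw [← hf.map_zero]
  exact hf.strictMonoOn.monotoneOn (Set.mem_Ici.2 le_rfl) hx hx

/-- An empty queue can only have weight below it pushing back, so dropping its service never lowers
the weight of a schedule. -/
theorem IsNetwork.pressure_nonpos (h : IsNetwork S R f l) {q : Fin N → ℝ} (hq : 0 ≤ q) {n : Fin N}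
    (hn : q n = 0) : pressure R f q n ≤ 0 := by
  rw [pressure_apply, hn, h.weight.map_zero, zero_sub, neg_nonpos]
  exact Finset.sum_nonneg fun m _ =>
    mul_nonneg (h.routing.entry_nonneg n m) (h.weight.nonneg (hq m))

/-! ### The schedule set -/

theorem IsMonotoneSchedules.update_mem (hS : IsMonotoneSchedules S) {π : Fin N → ℝ} (hπ : π ∈ S)
    (n : Fin N) : Function.update π n 0 ∈ S := by
  refine hS π hπ _ fun m => ?_
  by_cases hm : m = n
  · subst hm; simp
  · simp [hm]

/-- The convex hull of a monotone set of schedules is closed downwards. -/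
theorem IsMonotoneSchedules.mem_convexHull_of_le (hS : IsMonotoneSchedules S)
    {σ x : Fin N → ℝ} (hσ : σ ∈ convexHull ℝ (S : Set (Fin N → ℝ))) (hx : 0 ≤ x) (hxσ : x ≤ σ) :
    x ∈ convexHull ℝ (S : Set (Fin N → ℝ)) := by
  set C := convexHull ℝ (S : Set (Fin N → ℝ)) with hC
  have hconv : Convex ℝ C := convex_convexHull _ _
  have hup : ∀ n, ∀ v ∈ C, Function.update v n 0 ∈ C := by
    intro n v hv
    let D : (Fin N → ℝ) →ₗ[ℝ] (Fin N → ℝ) :=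
      { toFun := fun v => Function.update v n 0
        map_add' := fun a b => by
          ext m; by_cases hm : m = n
          · subst hm; simp
          · simp [hm]
        map_smul' := fun c a => by
          ext m; by_cases hm : m = n
          · subst hm; simp
          · simp [hm] }
    have : C ⊆ D ⁻¹' C := convexHull_min
      (fun π hπ => subset_convexHull ℝ _ (hS.update_mem hπ n)) (hconv.linear_preimage D)
    exact this hv
  -- Induction on the set of coordinates in which x is allowed to fall below σ.
  have key : ∀ s : Finset (Fin N), ∀ x : Fin N → ℝ, 0 ≤ x → x ≤ σ → (∀ n ∉ s, x n = σ n) →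
      x ∈ C := by
    intro s
    induction s using Finset.induction_on with
    | empty =>
      intro x _ _ hxs
      have : x = σ := funext fun n => hxs n (by simp)
      rwa [this]
    | insert a s ha ih =>
      intro x hx hxσ hxs
      have h1 : Function.update x a (σ a) ∈ C := by
        refine ih _ ?_ ?_ ?_
        · intro n; by_cases hn : n = a
          · subst hn; simpa using (hx n).trans (hxσ n)
          · simpa [hn] using hx n
        · intro n; by_cases hn : n = a
          · subst hn; simp
          · simpa [hn] using hxσ n
        · intro n hns; by_cases hn : n = a
          · subst hn; simp
          · simpa [hn] using hxs n (by simp [hn, hns])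
      have h2 := hup a _ h1
      rw [Function.update_idem] at h2
      rcases eq_or_lt_of_le ((hx a).trans (hxσ a)) with h0 | h0
      · have h3 : x a = σ a := le_antisymm (hxσ a) (by rw [← h0]; exact hx a)
        rwa [← h3, Function.update_eq_self] at h1
      · have h0' : (0 : ℝ) < σ a := h0
        have hle : x a / σ a ≤ 1 := (div_le_one h0').2 (hxσ a)
        -- Coordinate a is lowered by mixing the point with σ a there and the point with 0 there, in
        -- proportion x a / σ a.
        have := hconv h1 h2 (a := x a / σ a) (b := 1 - x a / σ a) (div_nonneg (hx a) h0'.le)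
          (by linarith) (by ring)
        convert this using 1
        ext n
        by_cases hn : n = a
        · subst hn; simp [h0'.ne']
        · simp [hn]; ring
  exact key Finset.univ x hx hxσ (by simp)

theorem IsNetwork.through_rate_nonneg (h : IsNetwork S R f l) : 0 ≤ through R l := h.admissible.1

theorem IsNetwork.through_rate_mem (h : IsNetwork S R f l) :
    through R l ∈ convexHull ℝ (S : Set (Fin N → ℝ)) := by
  obtain ⟨h0, σ, hσ, hle⟩ := h.admissible
  exact h.monotone.mem_convexHull_of_le hσ h0 hle

theorem IsNetwork.exists_weights (h : IsNetwork S R f l) :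
    ∃ c : (Fin N → ℝ) → ℝ, (∀ π ∈ S, 0 ≤ c π) ∧ ∑ π ∈ S, c π = 1 ∧ ∑ π ∈ S, c π • π = through R l :=
  Finset.mem_convexHull'.1 h.through_rate_mem

theorem IsNetwork.nonempty (h : IsNetwork S R f l) : S.Nonempty :=
  Finset.coe_nonempty.1 (convexHull_nonempty_iff.1 ⟨_, h.through_rate_mem⟩)

theorem sum_smul_dotProduct {ι : Type*} (s : Finset ι) (c : ι → ℝ) (v : ι → Fin N → ℝ)
    (w : Fin N → ℝ) : (∑ i ∈ s, c i • v i) ⬝ᵥ w = ∑ i ∈ s, c i * (v i ⬝ᵥ w) := by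
  rw [sum_dotProduct]
  exact Finset.sum_congr rfl fun i _ => by rw [smul_dotProduct, smul_eq_mul]

theorem IsNetwork.rate_dotProduct_le (h : IsNetwork S R f l) {w : Fin N → ℝ} {M : ℝ}
    (hM : ∀ π ∈ S, π ⬝ᵥ w ≤ M) : through R l ⬝ᵥ w ≤ M := by
  obtain ⟨c, hc0, hc1, hc⟩ := h.exists_weights
  rw [← hc, sum_smul_dotProduct, ← one_mul M, ← hc1, Finset.sum_mul]
  exact Finset.sum_le_sum fun π hπ => mul_le_mul_of_nonneg_left (hM π hπ) (hc0 π hπ)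

/-- Every schedule can be trimmed to one that serves only queues satisfying `p`. -/
theorem IsMonotoneSchedules.trim_mem (hS : IsMonotoneSchedules S) {π : Fin N → ℝ} (hπ : π ∈ S)
    (p : Fin N → Prop) [DecidablePred p] : (fun n => if p n then π n else 0) ∈ S :=
  hS π hπ _ fun n => by by_cases hn : p n <;> simp [hn]

/-! ### Balanced states -/

/-- At the state `q`, the offered work achieves the maximal weight of a schedule. -/
def IsBalanced (S : Finset (Fin N → ℝ)) (R : Matrix (Fin N) (Fin N) ℝ) (f : ℝ → ℝ)
    (l q : Fin N → ℝ) : Prop :=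
  ∀ ρ ∈ S, ρ ⬝ᵥ pressure R f q ≤ through R l ⬝ᵥ pressure R f q

/-- Complementary slackness: in a convex decomposition of λ̃, balance forces every schedule of
nonzero weight to be maximal, and the scaling assumption on f keeps each of these maximal. -/
theorem IsNetwork.isBalanced_smul (h : IsNetwork S R f l) {q : Fin N → ℝ} (hq : 0 ≤ q)
    (hb : IsBalanced S R f l q) {κ : ℝ} (hκ : 0 ≤ κ) : IsBalanced S R f l (κ • q) := by
  intro ρ hρ
  obtain ⟨c, hc0, hc1, hc⟩ := h.exists_weights
  have hsum : ∑ π ∈ S, c π * (through R l ⬝ᵥ pressure R f q - π ⬝ᵥ pressure R f q) = 0 := by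
    simp_rw [mul_sub]
    rw [Finset.sum_sub_distrib, ← Finset.sum_mul, hc1, one_mul, ← sum_smul_dotProduct, hc, sub_self]
  have hz := (Finset.sum_eq_zero_iff_of_nonneg fun π hπ =>
    mul_nonneg (hc0 π hπ) (sub_nonneg.2 (hb π hπ))).1 hsum
  rw [← hc, sum_smul_dotProduct, ← one_mul (ρ ⬝ᵥ _), ← hc1, Finset.sum_mul]
  refine Finset.sum_le_sum fun π hπ => ?_
  rcases mul_eq_zero.1 (hz π hπ) with h0 | h0
  · simp [h0]
  · refine mul_le_mul_of_nonneg_left ?_ (hc0 π hπ)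
    exact h.weight.scale q hq π hπ (fun ρ' hρ' => (hb ρ' hρ').trans (sub_nonpos.1 h0.le)) κ hκ ρ hρ

/-- By monotonicity of S, a weight bound valid for all schedules thus extends to the positive part
of w. -/
theorem dotProduct_trim_pos (π w : Fin N → ℝ) :
    (fun n => if 0 < w n then π n else 0) ⬝ᵥ w = π ⬝ᵥ (fun n => max (w n) 0) := by
  refine Finset.sum_congr rfl fun n _ => ?_
  by_cases hn : 0 < w n
  · simp [hn, hn.le]
  · simp [hn, not_lt.1 hn]

/-! ### The dual feasible region -/

theorem IsNetwork.isCompact_dualFeasible (h : IsNetwork S R f l) : IsCompact (dualFeasible S) := by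
  choose π hπ hpos using h.served
  refine (isCompact_Icc (a := (0 : Fin N → ℝ)) (b := fun n => 1 / π n n)).of_isClosed_subset ?_ ?_
  · have : dualFeasible S = {ξ | 0 ≤ ξ} ∩ ⋂ ρ ∈ S, {ξ | ξ ⬝ᵥ ρ ≤ 1} := by
      ext ξ; simp [dualFeasible]
    rw [this]
    refine (isClosed_le continuous_const continuous_id).inter
      (isClosed_biInter fun ρ _ => isClosed_le ?_ continuous_const)
    exact Continuous.dotProduct continuous_id continuous_const
  · intro ξ hξ
    refine ⟨hξ.1, fun n => ?_⟩
    rw [le_div_iff₀ (hpos n)]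
    refine le_trans ?_ (hξ.2 _ (hπ n))
    exact Finset.single_le_sum (f := fun m => ξ m * π n m)
      (fun m _ => mul_nonneg (hξ.1 m) (h.sched_nonneg _ (hπ n) m)) (Finset.mem_univ n)

/-- An extreme point is determined by its set of active constraints: if ζ has the same ones as ξ,
the segment from ζ to ξ can be prolonged beyond ξ within the region. -/
theorem finite_extremePoints_dualFeasible (S : Finset (Fin N → ℝ)) :
    ((dualFeasible S).extremePoints ℝ).Finite := by
  classical
  let act : (Fin N → ℝ) → Set (Fin N) × Set S := fun ξ =>
    ({n | ξ n = 0}, {π | ξ ⬝ᵥ (π : Fin N → ℝ) = 1})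
  refine Set.Finite.of_injOn (f := act) (t := Set.univ) (fun _ _ => Set.mem_univ _) ?_
    Set.finite_univ
  intro ξ hξ ζ hζ hact
  have hA : ∀ n, ξ n = 0 ↔ ζ n = 0 := fun n => by
    have := congrArg (fun p => n ∈ p.1) hact
    simpa [act] using this
  have hB : ∀ π : S, ξ ⬝ᵥ (π : Fin N → ℝ) = 1 ↔ ζ ⬝ᵥ (π : Fin N → ℝ) = 1 := fun π => by
    have := congrArg (fun p => π ∈ p.2) hact
    simpa [act] using this
  have e1 : ∀ᶠ ε : ℝ in nhdsWithin 0 (Set.Ioi 0), ∀ n, 0 ≤ (ξ + ε • (ξ - ζ)) n := by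
    rw [Filter.eventually_all]
    intro n
    by_cases hn : ξ n = 0
    · exact Filter.Eventually.of_forall fun ε => by simp [hn, (hA n).1 hn]
    · have hpos : 0 < ξ n := lt_of_le_of_ne (hξ.1.1 n) (Ne.symm hn)
      have ht : Filter.Tendsto (fun ε : ℝ => (ξ + ε • (ξ - ζ)) n) (nhdsWithin 0 (Set.Ioi 0))
          (nhds (ξ n + 0 * (ξ n - ζ n))) := by
        have hc : Continuous fun ε : ℝ => ξ n + ε * (ξ n - ζ n) := by fun_prop
        exact (hc.tendsto 0).mono_left nhdsWithin_le_nhds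
      exact (ht.eventually (lt_mem_nhds (by simpa using hpos))).mono fun _ h => h.le
  have e2 : ∀ᶠ ε : ℝ in nhdsWithin 0 (Set.Ioi 0), ∀ π : S,
      (ξ + ε • (ξ - ζ)) ⬝ᵥ (π : Fin N → ℝ) ≤ 1 := by
    rw [Filter.eventually_all]
    intro π
    simp_rw [add_dotProduct, smul_dotProduct, sub_dotProduct, smul_eq_mul]
    by_cases hn : ξ ⬝ᵥ (π : Fin N → ℝ) = 1
    · exact Filter.Eventually.of_forall fun ε => by simp [hn, (hB π).1 hn]
    · have hlt : ξ ⬝ᵥ (π : Fin N → ℝ) < 1 := lt_of_le_of_ne (hξ.1.2 π π.2) hn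
      have ht : Filter.Tendsto (fun ε : ℝ => ξ ⬝ᵥ (π : Fin N → ℝ) +
          ε * (ξ ⬝ᵥ (π : Fin N → ℝ) - ζ ⬝ᵥ (π : Fin N → ℝ))) (nhdsWithin 0 (Set.Ioi 0))
          (nhds (ξ ⬝ᵥ (π : Fin N → ℝ) + 0 * (ξ ⬝ᵥ (π : Fin N → ℝ) - ζ ⬝ᵥ (π : Fin N → ℝ)))) := by
        have hc : Continuous fun ε : ℝ => ξ ⬝ᵥ (π : Fin N → ℝ) +
            ε * (ξ ⬝ᵥ (π : Fin N → ℝ) - ζ ⬝ᵥ (π : Fin N → ℝ)) := by fun_prop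
        exact (hc.tendsto 0).mono_left nhdsWithin_le_nhds
      exact (ht.eventually (gt_mem_nhds (by simpa using hlt))).mono fun _ h => h.le
  obtain ⟨ε, ⟨h1, h2⟩, hε⟩ := ((e1.and e2).and self_mem_nhdsWithin).exists
  have hε : (0 : ℝ) < ε := hε
  have hmem : ξ + ε • (ξ - ζ) ∈ dualFeasible S := ⟨h1, fun π hπ => h2 ⟨π, hπ⟩⟩
  refine (hξ.2 hζ.1 hmem ?_).symm
  rw [openSegment_eq_image]
  -- ξ is the mixture of ζ and ξ + ε(ξ - ζ) with weight 1 / (1 + ε) on the latter.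
  refine ⟨1 / (1 + ε), ⟨by positivity, (div_lt_one (by positivity)).2 (by linarith)⟩, ?_⟩
  ext n
  simp
  field_simp
  ring

/-- The functional of evaluating the dot product with `x`. -/
def dotCLM (x : Fin N → ℝ) : (Fin N → ℝ) →L[ℝ] ℝ :=
  LinearMap.toContinuousLinearMap
    { toFun := fun ξ => ξ ⬝ᵥ x
      map_add' := fun a b => add_dotProduct a b x
      map_smul' := fun c a => smul_dotProduct c a x }

theorem dotCLM_apply (x ξ : Fin N → ℝ) : dotCLM x ξ = ξ ⬝ᵥ x := rfl

theorem IsNetwork.dual_le_one (h : IsNetwork S R f l) {ζ : Fin N → ℝ} (hζ : ζ ∈ dualFeasible S) :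
    ζ ⬝ᵥ through R l ≤ 1 := by
  rw [dotProduct_comm]
  exact h.rate_dotProduct_le fun π hπ => by rw [dotProduct_comm]; exact hζ.2 π hπ

/-- The constraints concern only critical resources, but x is minimised over the whole tight face at
an extreme point, and a maximal extreme point above it differs from it only where λ̃ vanishes. There
x ≤ 0, so passing to the maximal point can only lower the pairing. -/
theorem IsNetwork.dual_dotProduct_nonneg (h : IsNetwork S R f l) {x ζ : Fin N → ℝ}
    (hx : ∀ ξ ∈ criticalResources S (through R l), 0 ≤ ξ ⬝ᵥ x)
    (hx0 : ∀ n, through R l n = 0 → x n ≤ 0)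
    (hζ : ζ ∈ dualFeasible S) (hζ1 : ζ ⬝ᵥ through R l = 1) : 0 ≤ ζ ⬝ᵥ x := by
  set D := dualFeasible S
  set A : Set (Fin N → ℝ) := {ξ ∈ D | ∀ ξ' ∈ D, dotCLM (through R l) ξ' ≤ dotCLM (through R l) ξ}
    with hA
  have hAD : IsExposed ℝ D A := fun _ => ⟨_, rfl⟩
  have hAc : IsCompact A := hAD.isCompact h.isCompact_dualFeasible
  have hζA : ζ ∈ A := ⟨hζ, fun ξ' hξ' => by
    rw [dotCLM_apply, dotCLM_apply, hζ1]; exact h.dual_le_one hξ'⟩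
  -- A is the face of the dual region tight at λ̃, and B the face of A minimising x; an extreme
  -- point of B is extreme in the whole region.
  set B : Set (Fin N → ℝ) := {ξ ∈ A | ∀ ξ' ∈ A, dotCLM (-x) ξ' ≤ dotCLM (-x) ξ} with hB
  have hBA : IsExposed ℝ A B := fun _ => ⟨_, rfl⟩
  have hBc : IsCompact B := hBA.isCompact hAc
  have hBne : B.Nonempty := by
    obtain ⟨b, hb, hmax⟩ := hAc.exists_isMaxOn ⟨ζ, hζA⟩ (dotCLM (-x)).continuous.continuousOn
    exact ⟨b, hb, hmax⟩
  obtain ⟨ξ, hξB⟩ := hBc.extremePoints_nonempty hBne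
  have hξE : ξ ∈ D.extremePoints ℝ :=
    (hAD.isExtreme.trans hBA.isExtreme).extremePoints_subset_extremePoints hξB
  have hξ1 : ξ ⬝ᵥ through R l = 1 :=
    le_antisymm (h.dual_le_one hξE.1) (hζ1 ▸ hξB.1.1.2 ζ hζ)
  have hle : ξ ⬝ᵥ x ≤ ζ ⬝ᵥ x := by
    have := hξB.1.2 ζ hζA
    simpa [dotCLM_apply] using this
  refine le_trans ?_ hle
  obtain ⟨ξ', hle', hξ'⟩ := (finite_extremePoints_dualFeasible S).exists_le_maximal hξE
  have hterm : ∀ n, 0 ≤ (ξ' n - ξ n) * through R l n := fun n =>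
    mul_nonneg (sub_nonneg.2 (hle' n)) (h.through_rate_nonneg n)
  have hsum : ∑ n, (ξ' n - ξ n) * through R l n = ξ' ⬝ᵥ through R l - 1 := by
    rw [← hξ1, ← sub_dotProduct]; rfl
  have hξ'1 : ξ' ⬝ᵥ through R l = 1 :=
    le_antisymm (h.dual_le_one hξ'.1.1) (sub_nonneg.1 (hsum ▸ Finset.sum_nonneg fun n _ => hterm n))
  rw [hξ'1, sub_self, Finset.sum_eq_zero_iff_of_nonneg fun n _ => hterm n] at hsum
  have hcrit : ξ' ∈ criticalResources S (through R l) :=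
    ⟨⟨hξ'.1, fun ζ' hζ' hl => le_antisymm hl (hξ'.2 hζ' hl)⟩, hξ'1⟩
  refine (hx ξ' hcrit).trans ?_
  refine Finset.sum_le_sum fun n _ => ?_
  rcases mul_eq_zero.1 (hsum n (Finset.mem_univ n)) with h0 | h0
  · rw [sub_eq_zero.1 h0]
  · exact mul_le_mul_of_nonpos_right (hle' n) (hx0 n h0)

open Filter Topology MeasureTheory

/-! ### The Lyapunov function -/

/-- The antiderivative of the weight function, extended linearly to the negative half line. -/
def potential (f : ℝ → ℝ) (x : ℝ) : ℝ := ∫ u in (0 : ℝ)..x, f (max u 0)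

/-- The Lyapunov function, extended to the whole space. -/
def energy (f : ℝ → ℝ) (q : Fin N → ℝ) : ℝ := ∑ n, potential f (q n)

theorem IsWeightFunction.continuous_max (hf : IsWeightFunction S R f) :
    Continuous fun x => f (max x 0) :=
  hf.continuousOn.comp_continuous (continuous_id.max continuous_const) fun x => le_max_right x 0

theorem IsWeightFunction.monotone_max (hf : IsWeightFunction S R f) :
    Monotone fun x => f (max x 0) := fun x y hxy =>
  hf.strictMonoOn.monotoneOn (le_max_right x 0) (le_max_right y 0) (max_le_max hxy le_rfl)

theorem IsWeightFunction.hasDerivAt_potential (hf : IsWeightFunction S R f) (x : ℝ) :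
    HasDerivAt (potential f) (f (max x 0)) x :=
  (hf.continuous_max.integral_hasStrictDerivAt 0 x).hasDerivAt

theorem IsWeightFunction.continuous_potential (hf : IsWeightFunction S R f) :
    Continuous (potential f) :=
  continuous_iff_continuousAt.2 fun x => (hf.hasDerivAt_potential x).continuousAt

theorem IsWeightFunction.continuous_energy (hf : IsWeightFunction S R f) :
    Continuous (energy f : (Fin N → ℝ) → ℝ) :=
  continuous_finsetSum _ fun n _ => hf.continuous_potential.comp (continuous_apply n)

/-- Convexity, from the mean value theorem and monotonicity of the derivative. -/
theorem IsWeightFunction.tangent_le_potential (hf : IsWeightFunction S R f) (x y : ℝ) :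
    potential f x + f (max x 0) * (y - x) ≤ potential f y := by
  rcases lt_trichotomy x y with hxy | rfl | hxy
  · obtain ⟨c, hc, hceq⟩ := exists_hasDerivAt_eq_slope (potential f) (fun x => f (max x 0)) hxy
      hf.continuous_potential.continuousOn fun z _ => hf.hasDerivAt_potential z
    rw [eq_div_iff (by linarith)] at hceq
    have := mul_le_mul_of_nonneg_right (hf.monotone_max hc.1.le) (sub_nonneg.2 hxy.le)
    simp only at this
    linarith
  · simp
  · obtain ⟨c, hc, hceq⟩ := exists_hasDerivAt_eq_slope (potential f) (fun x => f (max x 0)) hxy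
      hf.continuous_potential.continuousOn fun z _ => hf.hasDerivAt_potential z
    rw [eq_div_iff (by linarith)] at hceq
    have := mul_le_mul_of_nonneg_right (hf.monotone_max hc.2.le) (sub_nonneg.2 hxy.le)
    simp only at this
    linarith

/-- Two non-strict tangent bounds chained through the midpoint, where the slope has strictly
changed. -/
theorem IsWeightFunction.tangent_lt_potential (hf : IsWeightFunction S R f) {x y : ℝ}
    (hx : 0 ≤ x) (hy : 0 ≤ y) (hxy : x ≠ y) :
    potential f x + f (max x 0) * (y - x) < potential f y := by
  have h1 := hf.tangent_le_potential x ((x + y) / 2)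
  have h2 := hf.tangent_le_potential ((x + y) / 2) y
  have hm : 0 ≤ (x + y) / 2 := by linarith
  rw [max_eq_left hx] at *
  rw [max_eq_left hm] at h2
  have h3 : 0 < (f ((x + y) / 2) - f x) * (y - x) := by
    rcases lt_or_gt_of_ne hxy with h | h
    · exact mul_pos (sub_pos.2 (hf.strictMonoOn hx hm (by linarith))) (by linarith)
    · exact mul_pos_of_neg_of_neg (sub_neg.2 (hf.strictMonoOn hm hx (by linarith))) (by linarith)
  nlinarith

theorem potential_eq {x : ℝ} (hx : 0 ≤ x) : potential f x = ∫ u in (0 : ℝ)..x, f u := by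
  refine intervalIntegral.integral_congr fun u hu => ?_
  rw [Set.uIcc_of_le hx] at hu
  exact congrArg f (max_eq_left hu.1)

theorem lyapunov_eq_energy {q : Fin N → ℝ} (hq : 0 ≤ q) : lyapunov f q = energy f q :=
  Finset.sum_congr rfl fun n _ => (potential_eq (hq n)).symm

theorem IsWeightFunction.energy_tangent_le (hf : IsWeightFunction S R f) {q : Fin N → ℝ}
    (hq : 0 ≤ q) (r : Fin N → ℝ) :
    energy f q + (fun n => f (q n)) ⬝ᵥ (r - q) ≤ energy f r := by
  rw [energy, dotProduct, ← Finset.sum_add_distrib]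
  refine Finset.sum_le_sum fun n _ => ?_
  have := hf.tangent_le_potential (q n) (r n)
  rwa [max_eq_left (show (0 : ℝ) ≤ q n from hq n)] at this

theorem IsWeightFunction.energy_tangent_lt (hf : IsWeightFunction S R f) {q r : Fin N → ℝ}
    (hq : 0 ≤ q) (hr : 0 ≤ r) (hqr : q ≠ r) :
    energy f q + (fun n => f (q n)) ⬝ᵥ (r - q) < energy f r := by
  rw [energy, dotProduct, ← Finset.sum_add_distrib]
  obtain ⟨n, hn⟩ := Function.ne_iff.1 hqr
  refine Finset.sum_lt_sum (fun n _ => ?_) ⟨n, Finset.mem_univ n, ?_⟩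
  · have := hf.tangent_le_potential (q n) (r n)
    rwa [max_eq_left (show (0 : ℝ) ≤ q n from hq n)] at this
  · have := hf.tangent_lt_potential (hq n) (hr n) hn
    rwa [max_eq_left (show (0 : ℝ) ≤ q n from hq n)] at this

theorem IsWeightFunction.potential_nonneg (hf : IsWeightFunction S R f) (x : ℝ) :
    0 ≤ potential f x := by
  have := hf.tangent_le_potential 0 x
  simpa [potential, hf.map_zero] using this

theorem IsWeightFunction.energy_nonneg (hf : IsWeightFunction S R f) (q : Fin N → ℝ) :
    0 ≤ energy f q :=
  Finset.sum_nonneg fun n _ => hf.potential_nonneg (q n)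

theorem isClosed_orthant : IsClosed {q : Fin N → ℝ | 0 ≤ q} :=
  isClosed_le continuous_const continuous_id

/-- The tangent at 1 has slope f 1 > 0, so the potential grows at least linearly. -/
theorem IsWeightFunction.isCompact_sublevel (hf : IsWeightFunction S R f) (K : ℝ) :
    IsCompact {q : Fin N → ℝ | 0 ≤ q ∧ energy f q ≤ K} := by
  have hf1 : 0 < f 1 := by
    rw [← hf.map_zero]
    exact hf.strictMonoOn (Set.mem_Ici.2 le_rfl) (Set.mem_Ici.2 zero_le_one) zero_lt_one
  refine (isCompact_Icc (a := (0 : Fin N → ℝ)) (b := fun _ => 1 + K / f 1)).of_isClosed_subset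
    (isClosed_orthant.inter (isClosed_le hf.continuous_energy continuous_const)) ?_
  rintro q ⟨hq, hK⟩
  refine ⟨hq, fun n => ?_⟩
  have h1 : potential f (q n) ≤ energy f q :=
    Finset.single_le_sum (f := fun n => potential f (q n))
      (fun m _ => hf.potential_nonneg (q m)) (Finset.mem_univ n)
  have h2 := hf.tangent_le_potential 1 (q n)
  have h3 := hf.potential_nonneg 1
  rw [max_eq_left zero_le_one] at h2
  have h4 : q n - 1 ≤ K / f 1 := by
    rw [le_div_iff₀ hf1]
    linarith
  linarith

/-! ### Feasible points -/

theorem IsFeasible.refl {q : Fin N → ℝ} (hq : 0 ≤ q) : IsFeasible S R l q q :=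
  ⟨hq, fun _ _ => le_rfl, fun _ _ => le_rfl⟩

theorem IsFeasible.trans {q r s : Fin N → ℝ} (h1 : IsFeasible S R l q r)
    (h2 : IsFeasible S R l r s) : IsFeasible S R l q s :=
  ⟨h2.nonneg, fun ξ hξ => (h1.workload ξ hξ).trans (h2.workload ξ hξ),
    fun n hn => (h2.unloaded n hn).trans (h1.unloaded n hn)⟩

/-- Transfers a feasible point from q to nearby q' as a competitor in the continuity proof. -/
theorem IsFeasible.smul_add {q q' r : Fin N → ℝ} (h : IsFeasible S R l q r) {c : ℝ} (hc : 0 ≤ c)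
    (hq : c • q ≤ q') : IsFeasible S R l q' (c • r + (q' - c • q)) := by
  refine ⟨add_nonneg (smul_nonneg hc h.nonneg) (sub_nonneg.2 hq), fun ξ hξ => ?_, fun n hn => ?_⟩
  · rw [through_add, through_sub, through_smul, through_smul, dotProduct_add, dotProduct_sub,
      dotProduct_smul, dotProduct_smul, smul_eq_mul, smul_eq_mul]
    have := mul_le_mul_of_nonneg_left (h.workload ξ hξ) hc
    linarith
  · rw [through_add, through_sub, through_smul, through_smul]
    have := mul_le_mul_of_nonneg_left (h.unloaded n hn) hc
    simp only [Pi.add_apply, Pi.sub_apply, Pi.smul_apply, smul_eq_mul]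
    linarith

theorem IsFeasible.midpoint {q r r' : Fin N → ℝ} (h : IsFeasible S R l q r)
    (h' : IsFeasible S R l q r') : IsFeasible S R l q ((1 / 2 : ℝ) • (r + r')) := by
  refine ⟨smul_nonneg (by norm_num) (add_nonneg h.nonneg h'.nonneg), fun ξ hξ => ?_,
    fun n hn => ?_⟩
  · rw [through_smul, through_add, dotProduct_smul, dotProduct_add, smul_eq_mul]
    have := h.workload ξ hξ
    have := h'.workload ξ hξ
    linarith
  · rw [through_smul, through_add]
    have := h.unloaded n hn
    have := h'.unloaded n hn
    simp only [Pi.add_apply, Pi.smul_apply, smul_eq_mul]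
    linarith

/-- Feasibility is preserved in the limit. -/
theorem IsFeasible.of_tendsto {ι : Type*} {u : Filter ι} [u.NeBot] {q r : Fin N → ℝ}
    {a b : ι → Fin N → ℝ} (ha : Tendsto a u (𝓝 q)) (hb : Tendsto b u (𝓝 r))
    (h : ∀ᶠ i in u, IsFeasible S R l (a i) (b i)) : IsFeasible S R l q r := by
  have hta := (continuous_through (R := R)).continuousAt.tendsto.comp ha
  have htb := (continuous_through (R := R)).continuousAt.tendsto.comp hb
  have hdot : ∀ ξ : Fin N → ℝ, Continuous fun x : Fin N → ℝ => ξ ⬝ᵥ x := fun ξ =>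
    Continuous.dotProduct continuous_const continuous_id
  refine ⟨ge_of_tendsto hb (h.mono fun i hi => hi.nonneg), fun ξ hξ => ?_, fun n hn => ?_⟩
  · exact le_of_tendsto_of_tendsto (((hdot ξ).continuousAt.tendsto).comp hta)
      (((hdot ξ).continuousAt.tendsto).comp htb) (h.mono fun i hi => hi.workload ξ hξ)
  · exact le_of_tendsto_of_tendsto (((continuous_apply n).continuousAt.tendsto).comp htb)
      (((continuous_apply n).continuousAt.tendsto).comp hta) (h.mono fun i hi => hi.unloaded n hn)

/-! ### The optimizer -/

theorem IsNetwork.exists_isOptimizer (h : IsNetwork S R f l) {q : Fin N → ℝ} (hq : 0 ≤ q) :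
    ∃ r, IsOptimizer S R f l q r := by
  set K : Set (Fin N → ℝ) := {r | 0 ≤ r ∧ energy f r ≤ energy f q} ∩ {r | IsFeasible S R l q r}
  have hclosed : IsClosed {r | IsFeasible S R l q r} := by
    rw [isClosed_iff_forall_filter]
    intro r F hF hle hr
    exact IsFeasible.of_tendsto (a := fun _ => q) (b := id) tendsto_const_nhds hr
      (le_principal_iff.1 hle)
  have hK : IsCompact K := (h.weight.isCompact_sublevel _).inter_right hclosed
  obtain ⟨r, hrK, hmin⟩ := hK.exists_isMinOn ⟨q, ⟨hq, le_rfl⟩, IsFeasible.refl hq⟩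
    h.weight.continuous_energy.continuousOn
  refine ⟨r, hrK.2, fun r' hr' => ?_⟩
  rw [lyapunov_eq_energy hrK.2.nonneg, lyapunov_eq_energy hr'.nonneg]
  rcases le_total (energy f r') (energy f q) with hle | hle
  · exact hmin ⟨⟨hr'.nonneg, hle⟩, hr'⟩
  · exact hrK.1.2.trans hle

theorem IsNetwork.isOptimizer_unique (h : IsNetwork S R f l) {q r r' : Fin N → ℝ}
    (hr : IsOptimizer S R f l q r) (hr' : IsOptimizer S R f l q r') : r = r' := by
  by_contra hne
  set m := (1 / 2 : ℝ) • (r + r') with hm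
  have hmf : IsFeasible S R l q m := hr.1.midpoint hr'.1
  have hne' : m ≠ r := fun he => hne <| by
    rw [he] at hm
    ext n
    have := congrFun hm n
    simp at this
    linarith
  have h1 := h.weight.energy_tangent_lt hmf.nonneg hr.1.nonneg hne'
  have h2 := h.weight.energy_tangent_le hmf.nonneg r'
  have h3 := hr.2 m hmf
  have h4 := hr'.2 m hmf
  rw [lyapunov_eq_energy hmf.nonneg, lyapunov_eq_energy hr.1.nonneg] at h3
  rw [lyapunov_eq_energy hmf.nonneg, lyapunov_eq_energy hr'.1.nonneg] at h4
  have h5 : (r' - m) = -(r - m) := by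
    rw [hm]; ext n; simp; ring
  rw [h5, dotProduct_neg] at h2
  linarith

theorem IsNetwork.liftingMap_spec (h : IsNetwork S R f l) {q : Fin N → ℝ} (hq : 0 ≤ q) :
    IsOptimizer S R f l q (liftingMap S R f l q) :=
  Classical.epsilon_spec (h.exists_isOptimizer hq)

theorem IsNetwork.eq_liftingMap (h : IsNetwork S R f l) {q r : Fin N → ℝ} (hq : 0 ≤ q)
    (hr : IsOptimizer S R f l q r) : r = liftingMap S R f l q :=
  h.isOptimizer_unique hr (h.liftingMap_spec hq)

theorem IsNetwork.eq_liftingMap_iff (h : IsNetwork S R f l) {q : Fin N → ℝ} (hq : 0 ≤ q) :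
    q = liftingMap S R f l q ↔ IsOptimizer S R f l q q :=
  ⟨fun he => by have := h.liftingMap_spec hq; rwa [← he] at this, h.eq_liftingMap hq⟩

theorem IsNetwork.energy_liftingMap_le (h : IsNetwork S R f l) {q r : Fin N → ℝ} (hq : 0 ≤ q)
    (hr : IsFeasible S R l q r) : energy f (liftingMap S R f l q) ≤ energy f r := by
  have := (h.liftingMap_spec hq).2 r hr
  rwa [lyapunov_eq_energy (h.liftingMap_spec hq).1.nonneg, lyapunov_eq_energy hr.nonneg] at this

theorem IsNetwork.eq_liftingMap_of_energy_le (h : IsNetwork S R f l) {q r : Fin N → ℝ}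
    (hq : 0 ≤ q) (hr : IsFeasible S R l q r)
    (hle : energy f r ≤ energy f (liftingMap S R f l q)) : r = liftingMap S R f l q := by
  refine h.eq_liftingMap hq ⟨hr, fun r' hr' => ?_⟩
  rw [lyapunov_eq_energy hr.nonneg, lyapunov_eq_energy hr'.nonneg]
  exact hle.trans (h.energy_liftingMap_le hq hr')

/-- Optimizers stay in a compact sublevel set, so it suffices that every cluster point is feasible
at q and has minimal energy there; uniqueness then identifies it. -/
theorem IsNetwork.continuousOn_liftingMap (h : IsNetwork S R f l) :
    ContinuousOn (liftingMap S R f l) {q | 0 ≤ q} := by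
  intro q hq
  have hq : 0 ≤ q := hq
  set W := liftingMap S R f l
  have hcE := h.weight.continuous_energy (N := N)
  have hev : ∀ᶠ q' in 𝓝[{q | 0 ≤ q}] q, 0 ≤ q' := self_mem_nhdsWithin
  refine (h.weight.isCompact_sublevel (energy f q + 1)).tendsto_nhds_of_unique_mapClusterPt ?_ ?_
  · have h1 : ∀ᶠ q' in 𝓝[{q | 0 ≤ q}] q, energy f q' < energy f q + 1 :=
      (hcE.continuousAt.tendsto.eventually
        (gt_mem_nhds (lt_add_one (energy f q)))).filter_mono nhdsWithin_le_nhds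
    filter_upwards [hev, h1] with q' h0 h1
    exact ⟨(h.liftingMap_spec h0).1.nonneg,
      (h.energy_liftingMap_le h0 (IsFeasible.refl h0)).trans h1.le⟩
  · intro r _ hr
    obtain ⟨U, hU, hUr⟩ := mapClusterPt_iff_ultrafilter.1 hr
    have hUq : Tendsto id (U : Filter (Fin N → ℝ)) (𝓝 q) := hU.trans nhdsWithin_le_nhds
    have hev' : ∀ᶠ q' in (U : Filter (Fin N → ℝ)), 0 ≤ q' := hU hev
    have hfeas : IsFeasible S R l q r := IsFeasible.of_tendsto hUq hUr
      (hev'.mono fun q' h0 => (h.liftingMap_spec h0).1)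
    refine h.eq_liftingMap_of_energy_le hq hfeas ?_
    have hW0 := (h.liftingMap_spec hq).1
    have key : ∀ c : ℝ, 0 ≤ c → c < 1 → energy f r ≤ energy f (c • W q + (q - c • q)) := by
      intro c hc hc1
      -- The factor c < 1 leaves room on positive coordinates; on zero coordinates the bound is just
      -- q' ≥ 0.
      have hle : ∀ᶠ q' in (U : Filter (Fin N → ℝ)), c • q ≤ q' := by
        have : ∀ᶠ q' in (U : Filter (Fin N → ℝ)), ∀ n, c * q n ≤ q' n := by
          rw [eventually_all]
          intro n
          rcases eq_or_lt_of_le (hq n) with h0 | h0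
          · filter_upwards [hev'] with q' h'
            rw [← h0]; simpa using h' n
          · have hn : Tendsto (fun q' : Fin N → ℝ => q' n) U (𝓝 (q n)) :=
              ((continuous_apply n).tendsto q).comp hUq
            have h0 : 0 < q n := h0
            exact (hn.eventually (lt_mem_nhds (a := c * q n) (by nlinarith))).mono
              fun _ h => h.le
        exact this
      refine le_of_tendsto_of_tendsto (hcE.continuousAt.tendsto.comp hUr)
        (hcE.continuousAt.tendsto.comp
          ((tendsto_const_nhds (x := c • W q)).add (hUq.sub (tendsto_const_nhds (x := c • q))))) ?_
      filter_upwards [hev', hle] with q' h0 h1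
      exact h.energy_liftingMap_le h0 (hW0.smul_add hc h1)
    have hlim : Tendsto (fun c : ℝ => energy f (c • W q + (q - c • q))) (𝓝[<] 1)
        (𝓝 (energy f ((1 : ℝ) • W q + (q - (1 : ℝ) • q)))) := by
      have hc : Continuous fun c : ℝ => energy f (c • W q + (q - c • q)) :=
        hcE.comp (by fun_prop)
      exact (hc.tendsto 1).mono_left nhdsWithin_le_nhds
    rw [one_smul, one_smul, sub_self, add_zero] at hlim
    refine ge_of_tendsto hlim ?_
    have h0 : ∀ᶠ c : ℝ in 𝓝[<] 1, 0 < c := nhdsWithin_le_nhds (lt_mem_nhds zero_lt_one)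
    filter_upwards [h0, self_mem_nhdsWithin] with c hc hc1
    exact key c hc.le hc1

/-! ### Fixed points of the lifting map are the balanced states -/

/-- By convexity it is enough that w·x ≥ 0 for the pressure w and x = r̃ - q̃; linear programming
duality supplies this through the positive part of w. -/
theorem IsNetwork.isOptimizer_of_isBalanced (h : IsNetwork S R f l) {q : Fin N → ℝ} (hq : 0 ≤ q)
    (hb : IsBalanced S R f l q) : IsOptimizer S R f l q q := by
  refine ⟨IsFeasible.refl hq, fun r hr => ?_⟩
  rw [lyapunov_eq_energy hq, lyapunov_eq_energy hr.nonneg]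
  refine le_trans ?_ (h.weight.energy_tangent_le hq r)
  rw [h.routing.weights_dotProduct, through_sub, dotProduct_comm, le_add_iff_nonneg_right]
  set x := through R r - through R q with hx
  set w := pressure R f q
  set M := through R l ⬝ᵥ w
  set wp : Fin N → ℝ := fun n => max (w n) 0 with hwp
  have hwp0 : 0 ≤ wp := fun n => le_max_right _ _
  have hM : ∀ π ∈ S, π ⬝ᵥ wp ≤ M := fun π hπ => by
    rw [← dotProduct_trim_pos]
    exact hb _ (h.monotone.trim_mem hπ _)
  have hx0 : ∀ n, through R l n = 0 → x n ≤ 0 := fun n hn => sub_nonpos.2 (hr.unloaded n hn)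
  have hterm : ∀ n, 0 ≤ through R l n * (wp n - w n) := fun n =>
    mul_nonneg (h.through_rate_nonneg n) (sub_nonneg.2 (le_max_left _ _))
  -- The positive part has weight at most M on λ̃, while w itself attains M, so the two agree
  -- wherever λ̃ is positive.
  have hzero : ∀ n, through R l n * (wp n - w n) = 0 := by
    have hle : ∑ n, through R l n * (wp n - w n) ≤ 0 := by
      have : ∑ n, through R l n * (wp n - w n) = through R l ⬝ᵥ wp - M := by
        rw [← dotProduct_sub]; rfl
      rw [this]
      exact sub_nonpos.2 (h.rate_dotProduct_le hM)
    have := (Finset.sum_eq_zero_iff_of_nonneg fun n _ => hterm n).1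
      (le_antisymm hle (Finset.sum_nonneg fun n _ => hterm n))
    exact fun n => this n (Finset.mem_univ n)
  have hMwp : through R l ⬝ᵥ wp = M := by
    refine Finset.sum_congr rfl fun n _ => ?_
    have := hzero n
    rw [mul_sub] at this
    linarith
  have hpos : 0 ≤ wp ⬝ᵥ x := by
    have hM0 : 0 ≤ M := hMwp ▸ dotProduct_nonneg_of_nonneg h.through_rate_nonneg hwp0
    -- When M = 0 normalising is impossible, but then `wp` vanishes because every queue is served.
    rcases eq_or_lt_of_le hM0 with h0 | h0
    · refine Finset.sum_nonneg fun n _ => ?_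
      obtain ⟨π, hπ, hn⟩ := h.served n
      have h1 : π n * wp n ≤ π ⬝ᵥ wp := Finset.single_le_sum (f := fun m => π m * wp m)
        (fun m _ => mul_nonneg (h.sched_nonneg π hπ m) (hwp0 m)) (Finset.mem_univ n)
      have h2 : π n * wp n ≤ 0 := h1.trans ((hM π hπ).trans h0.ge)
      have h3 : wp n = 0 := le_antisymm (nonpos_of_mul_nonpos_right h2 hn) (hwp0 n)
      simp [h3]
    · have hζ : M⁻¹ • wp ∈ dualFeasible S := by
        refine ⟨smul_nonneg (inv_nonneg.2 hM0) hwp0, fun π hπ => ?_⟩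
        rw [smul_dotProduct, smul_eq_mul, dotProduct_comm, inv_mul_le_one₀ h0]
        exact hM π hπ
      have := h.dual_dotProduct_nonneg (x := x) (fun ξ hξ => ?_) hx0 hζ ?_
      · rw [smul_dotProduct, smul_eq_mul] at this
        exact nonneg_of_mul_nonneg_right this (inv_pos.2 h0)
      · rw [hx, dotProduct_sub]
        exact sub_nonneg.2 (hr.workload ξ hξ)
      · rw [smul_dotProduct, smul_eq_mul, dotProduct_comm, hMwp, inv_mul_cancel₀ h0.ne']
  refine hpos.trans (Finset.sum_le_sum fun n _ => ?_)
  rcases mul_eq_zero.1 (hzero n) with h0 | h0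
  · exact mul_le_mul_of_nonpos_right (le_max_left _ _) (hx0 n h0)
  · rw [sub_eq_zero.1 h0]

/-- The drift d of the state under a schedule is a feasible direction, and the one-sided derivative
of L along it is the weight of λ̃ minus that of the schedule. -/
theorem IsNetwork.isBalanced_of_isOptimizer (h : IsNetwork S R f l) {q : Fin N → ℝ} (hq : 0 ≤ q)
    (ho : IsOptimizer S R f l q q) : IsBalanced S R f l q := by
  intro ρ hρ
  -- Serving only nonempty queues keeps q + ε d nonnegative for small ε.
  set ρ' : Fin N → ℝ := fun n => if 0 < q n then ρ n else 0 with hρ'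
  have hρ'S : ρ' ∈ S := h.monotone.trim_mem hρ _
  have hle : ρ ⬝ᵥ pressure R f q ≤ ρ' ⬝ᵥ pressure R f q := by
    refine Finset.sum_le_sum fun n _ => ?_
    by_cases hn : 0 < q n
    · simp [hρ', hn]
    · have h0 : q n = 0 := le_antisymm (not_lt.1 hn) (hq n)
      simp only [hρ', hn, if_false, zero_mul]
      exact mul_nonpos_of_nonneg_of_nonpos (h.sched_nonneg ρ hρ n) (h.pressure_nonpos hq h0)
  refine hle.trans ?_
  set d := l - (1 - Rᵀ) *ᵥ ρ' with hd
  have htd : through R d = through R l - ρ' := by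
    rw [hd, through_sub, h.routing.through_mulVec]
  rw [← sub_nonneg, ← sub_dotProduct, ← htd, ← h.routing.weights_dotProduct]
  have hnn : ∀ᶠ ε : ℝ in 𝓝[>] 0, 0 ≤ q + ε • d := by
    have : ∀ᶠ ε : ℝ in 𝓝[>] 0, ∀ n, 0 ≤ q n + ε * d n := by
      rw [eventually_all]
      intro n
      by_cases hn : 0 < q n
      · have hc : Continuous fun ε : ℝ => q n + ε * d n := by fun_prop
        exact (((hc.tendsto 0).mono_left nhdsWithin_le_nhds).eventually
          (lt_mem_nhds (by simpa using hn))).mono fun _ h => h.le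
      · have h0 : q n = 0 := le_antisymm (not_lt.1 hn) (hq n)
        have hdn : 0 ≤ d n := by
          rw [hd, Pi.sub_apply, one_sub_transpose_mulVec_apply]
          have h1 : ρ' n = 0 := by simp [hρ', h0]
          have h2 : 0 ≤ ∑ m, R m n * ρ' m := Finset.sum_nonneg fun m _ =>
            mul_nonneg (h.routing.entry_nonneg m n) (h.sched_nonneg ρ' hρ'S m)
          have h3 : 0 ≤ l n := h.rate_nonneg n
          linarith
        filter_upwards [self_mem_nhdsWithin] with ε hε
        have hε : 0 < ε := hε
        rw [h0]; positivity
    exact this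
  have hfeas : ∀ ε : ℝ, 0 < ε → 0 ≤ q + ε • d → IsFeasible S R l q (q + ε • d) := by
    intro ε hε h0
    refine ⟨h0, fun ξ hξ => ?_, fun n hn => ?_⟩
    · rw [through_add, through_smul, htd, dotProduct_add, dotProduct_smul, dotProduct_sub, hξ.2,
        le_add_iff_nonneg_right]
      exact mul_nonneg hε.le (sub_nonneg.2 (hξ.1.1.1.2 ρ' hρ'S))
    · rw [through_add, through_smul, htd, Pi.add_apply, Pi.smul_apply, Pi.sub_apply, hn]
      have := mul_nonneg hε.le (h.sched_nonneg ρ' hρ'S n)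
      simp only [smul_eq_mul]
      linarith
  have hlim : Tendsto (fun ε : ℝ => ∑ n, f (max (q n + ε * d n) 0) * d n) (𝓝[>] 0)
      (𝓝 (∑ n, f (max (q n + 0 * d n) 0) * d n)) := by
    have hc : Continuous fun ε : ℝ => ∑ n, f (max (q n + ε * d n) 0) * d n :=
      continuous_finsetSum _ fun n _ =>
        (h.weight.continuous_max.comp (by fun_prop : Continuous fun ε : ℝ => q n + ε * d n)).mul
          continuous_const
    exact (hc.tendsto 0).mono_left nhdsWithin_le_nhds
  have hval : ∑ n, f (max (q n + 0 * d n) 0) * d n = (fun n => f (q n)) ⬝ᵥ d :=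
    Finset.sum_congr rfl fun n _ => by
      rw [zero_mul, add_zero, max_eq_left (show (0 : ℝ) ≤ q n from hq n)]
  rw [hval] at hlim
  refine ge_of_tendsto hlim ?_
  filter_upwards [hnn, self_mem_nhdsWithin] with ε h0 hε
  have hε : 0 < ε := hε
  have h1 := ho.2 _ (hfeas ε hε h0)
  rw [lyapunov_eq_energy hq, lyapunov_eq_energy h0] at h1
  -- The tangent is taken at the moved point, so minimality of q gives f(q + ε d)·d ≥ 0; then ε → 0.
  have h2 := h.weight.energy_tangent_le h0 q
  have h3 : q - (q + ε • d) = -(ε • d) := by abel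
  rw [h3, dotProduct_neg, dotProduct_smul, smul_eq_mul] at h2
  have h4 : 0 ≤ ε * ((fun n => f ((q + ε • d) n)) ⬝ᵥ d) := by linarith
  have h5 := nonneg_of_mul_nonneg_right h4 hε
  convert h5 using 1
  refine Finset.sum_congr rfl fun n _ => ?_
  have : 0 ≤ q n + ε * d n := h0 n
  simp [max_eq_left this]

theorem IsNetwork.eq_liftingMap_iff_isBalanced (h : IsNetwork S R f l) {q : Fin N → ℝ}
    (hq : 0 ≤ q) : q = liftingMap S R f l q ↔ IsBalanced S R f l q :=
  (h.eq_liftingMap_iff hq).trans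
    ⟨h.isBalanced_of_isOptimizer hq, h.isOptimizer_of_isBalanced hq⟩

theorem IsNetwork.liftingMap_smul (h : IsNetwork S R f l) {q : Fin N → ℝ} (hq : 0 ≤ q)
    (hfix : q = liftingMap S R f l q) {κ : ℝ} (hκ : 0 ≤ κ) :
    liftingMap S R f l (κ • q) = κ • liftingMap S R f l q := by
  rw [← hfix]
  exact ((h.eq_liftingMap_iff_isBalanced (smul_nonneg hκ hq)).2
    (h.isBalanced_smul hq ((h.eq_liftingMap_iff_isBalanced hq).1 hfix) hκ)).symm

/-! ### Absolutely continuous functions -/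

theorem _root_.AbsolutelyContinuousOnInterval.le_of_ae_deriv_nonpos {g : ℝ → ℝ} {a b : ℝ}
    (hab : a ≤ b) (hg : AbsolutelyContinuousOnInterval g a b)
    (hd : ∀ᵐ t, t ∈ Set.Ioo a b → deriv g t ≤ 0) : g b ≤ g a := by
  rw [← sub_nonpos, ← hg.integral_deriv_eq_sub, intervalIntegral.integral_of_le hab]
  refine setIntegral_nonpos_of_ae_restrict ?_
  rw [← Measure.restrict_congr_set (Ioo_ae_eq_Ioc (μ := volume)),
    EventuallyLE, ae_restrict_iff' measurableSet_Ioo]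
  exact hd

theorem _root_.AbsolutelyContinuousOnInterval.sum {ι : Type*} {g : ι → ℝ → ℝ} {a b : ℝ}
    (s : Finset ι) (hg : ∀ i ∈ s, AbsolutelyContinuousOnInterval (g i) a b) :
    AbsolutelyContinuousOnInterval (fun t => ∑ i ∈ s, g i t) a b := by
  classical
  induction s using Finset.induction_on with
  | empty =>
    simp only [Finset.sum_empty]
    exact (LipschitzWith.const (0 : ℝ)).lipschitzOnWith.absolutelyContinuousOnInterval
  | insert i s hi ih =>
    simp only [Finset.sum_insert hi]
    exact (hg i (by simp)).fun_add (ih fun j hj => hg j (by simp [hj]))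

theorem _root_.AbsolutelyContinuousOnInterval.comp_lipschitzOnWith {g F : ℝ → ℝ} {a b : ℝ}
    {s : Set ℝ} {K : NNReal} (hF : LipschitzOnWith K F s)
    (hg : AbsolutelyContinuousOnInterval g a b) (hs : Set.MapsTo g (Set.uIcc a b) s) :
    AbsolutelyContinuousOnInterval (fun t => F (g t)) a b := by
  have h0 := Tendsto.const_mul (K : ℝ) hg
  rw [mul_zero] at h0
  refine squeeze_zero' (Eventually.of_forall fun E => Finset.sum_nonneg fun _ _ => dist_nonneg)
    ?_ h0
  filter_upwards [mem_inf_of_right (mem_principal_self _)] with E hE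
  rw [Finset.mul_sum]
  exact Finset.sum_le_sum fun i hi => hF.dist_le_mul _ (hs (hE.1 i hi).1) _ (hs (hE.1 i hi).2)

theorem _root_.AbsolutelyContinuousOnInterval.linear (c a b : ℝ) :
    AbsolutelyContinuousOnInterval (fun t => c * t) a b :=
  (contDiff_const.mul contDiff_id).contDiffOn.absolutelyContinuousOnInterval

theorem IsWeightFunction.absolutelyContinuous_potential (hf : IsWeightFunction S R f)
    {g : ℝ → ℝ} {a b : ℝ} (hg : AbsolutelyContinuousOnInterval g a b) :
    AbsolutelyContinuousOnInterval (fun t => potential f (g t)) a b := by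
  obtain ⟨C, hC⟩ := hg.exists_bound
  have hF : ContDiff ℝ 1 (potential f) := by
    rw [contDiff_one_iff_deriv]
    refine ⟨fun x => (hf.hasDerivAt_potential x).differentiableAt, ?_⟩
    rw [show deriv (potential f) = fun x => f (max x 0) from
      funext fun x => (hf.hasDerivAt_potential x).deriv]
    exact hf.continuous_max
  obtain ⟨K, hK⟩ := hF.contDiffOn.exists_lipschitzOnWith (by decide) (convex_Icc (-C) C)
    isCompact_Icc
  exact AbsolutelyContinuousOnInterval.comp_lipschitzOnWith hK hg fun t ht => abs_le.1 (hC t ht)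

/-! ### Fluid model solutions -/

theorem zero_mem_horizon {T : EReal} (hT : 0 < T) : (0 : ℝ) ∈ horizon T :=
  ⟨le_rfl, by simpa using hT.le⟩

theorem mem_horizon_of_le {T : EReal} {a b : ℝ} (hb : b ∈ horizon T) (ha : 0 ≤ a) (hab : a ≤ b) :
    a ∈ horizon T :=
  ⟨ha, (EReal.coe_le_coe_iff.2 hab).trans hb.2⟩

theorem lt_of_lt_mem_horizon {T : EReal} {a b : ℝ} (hb : b ∈ horizon T) (hab : a < b) :
    (a : EReal) < T :=
  (EReal.coe_lt_coe_iff.2 hab).trans_le hb.2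

theorem horizon_mem_nhds {T : EReal} {u : ℝ} (hu : 0 < u) (huT : (u : EReal) < T) :
    horizon T ∈ 𝓝 u := by
  filter_upwards [lt_mem_nhds hu,
    continuous_coe_real_ereal.continuousAt.tendsto.eventually (gt_mem_nhds huT)] with t h1 h2
  exact ⟨h1.le, h2.le⟩

/-- The work that has left the queues up to time `t`. -/
def FluidPath.output (x : FluidPath S) (t : ℝ) : Fin N → ℝ := x.service t - x.y t

/-- The rates at which the schedules are used. -/
def FluidPath.rate (x : FluidPath S) (t : ℝ) : Fin N → ℝ :=
  ∑ π : S, deriv (x.s π) t • (π : Fin N → ℝ)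

theorem FluidPath.output_apply (x : FluidPath S) (t : ℝ) (n : Fin N) :
    x.output t n = ∑ π : S, x.s π t * (π : Fin N → ℝ) n - x.y t n := by
  simp [FluidPath.output, FluidPath.service, Finset.sum_apply]

theorem FluidPath.rate_apply (x : FluidPath S) (t : ℝ) (n : Fin N) :
    x.rate t n = ∑ π : S, deriv (x.s π) t * (π : Fin N → ℝ) n := by
  simp [FluidPath.rate, Finset.sum_apply]

/-- The rates at which work leaves the queues. -/
def FluidPath.outputRate (x : FluidPath S) (t : ℝ) : Fin N → ℝ :=
  x.rate t - fun n => deriv (fun u => x.y u n) t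

theorem FluidPath.outputRate_apply (x : FluidPath S) (t : ℝ) (n : Fin N) :
    x.outputRate t n = x.rate t n - deriv (fun u => x.y u n) t := rfl

theorem FluidPath.IsRegular.hasDerivAt_output {x : FluidPath S} {t : ℝ} (hr : x.IsRegular t)
    (n : Fin N) : HasDerivAt (fun u => x.output u n) (x.outputRate t n) t := by
  simp only [FluidPath.output_apply, FluidPath.outputRate_apply, FluidPath.rate_apply]
  exact (HasDerivAt.fun_sum fun π _ => (hr.s π).hasDerivAt.mul_const _).sub (hr.y n).hasDerivAt

namespace IsFluidSolution

variable {T : EReal} {x : FluidPath S}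

theorem ae_isRegular (hx : IsFluidSolution S R f l T x) {b : ℝ} (hb : b ∈ horizon T) :
    ∀ᵐ u, u ∈ Set.Ioo 0 b → x.IsRegular u := by
  have hsub : ∀ u ∈ Set.Ioo 0 b, u ∈ Set.uIcc 0 b := fun u hu => by
    rw [Set.uIcc_of_le hb.1]; exact Set.Ioo_subset_Icc_self hu
  have h1 := ae_all_iff.2 fun n => (hx.q_abs_cont n b hb).ae_differentiableAt
  have h2 := ae_all_iff.2 fun n => (hx.a_abs_cont n b hb).ae_differentiableAt
  have h3 := ae_all_iff.2 fun n => (hx.y_abs_cont n b hb).ae_differentiableAt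
  have h4 := ae_all_iff.2 fun π => (hx.s_abs_cont π b hb).ae_differentiableAt
  filter_upwards [h1, h2, h3, h4] with u h1 h2 h3 h4 hu
  exact ⟨fun n => h1 n (hsub u hu), fun n => h2 n (hsub u hu), fun n => h3 n (hsub u hu),
    fun π => h4 π (hsub u hu)⟩

theorem queue_eq (hx : IsFluidSolution S R f l T x) {t : ℝ} (ht : t ∈ horizon T) :
    x.q t = x.q 0 + t • l - (1 - Rᵀ) *ᵥ x.output t := by
  rw [hx.queue t ht, hx.arrivals t ht, FluidPath.output]

theorem through_queue (hR : IsAcyclicRouting R) (hx : IsFluidSolution S R f l T x) {t : ℝ}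
    (ht : t ∈ horizon T) :
    through R (x.q t) = through R (x.q 0) + t • through R l - x.output t := by
  rw [hx.queue_eq ht, through_sub, through_add, through_smul, hR.through_mulVec]

theorem output_abs_cont (hx : IsFluidSolution S R f l T x) {b : ℝ} (hb : b ∈ horizon T)
    (n : Fin N) : AbsolutelyContinuousOnInterval (fun u => x.output u n) 0 b := by
  simp only [FluidPath.output_apply, mul_comm]
  exact (AbsolutelyContinuousOnInterval.sum _ fun π _ => (hx.s_abs_cont π b hb).const_mul _).fun_sub
    (hx.y_abs_cont n b hb)

/-! ### Derivatives of a fluid solution at a regular time -/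

section Rates

variable {u : ℝ}

theorem s_deriv_nonneg (hx : IsFluidSolution S R f l T x) (hu : 0 < u) (huT : (u : EReal) < T)
    (π : S) : 0 ≤ deriv (x.s π) u := by
  rw [← derivWithin_of_mem_nhds (horizon_mem_nhds hu huT)]
  exact (hx.s_mono π).derivWithin_nonneg

theorem y_deriv_nonneg (hx : IsFluidSolution S R f l T x) (hu : 0 < u) (huT : (u : EReal) < T)
    (n : Fin N) : 0 ≤ deriv (fun t => x.y t n) u := by
  rw [← derivWithin_of_mem_nhds (horizon_mem_nhds hu huT)]
  exact (hx.y_mono n).derivWithin_nonneg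

theorem sum_s_deriv (hx : IsFluidSolution S R f l T x) (hu : 0 < u) (huT : (u : EReal) < T)
    (hr : x.IsRegular u) : ∑ π : S, deriv (x.s π) u = 1 := by
  have h1 : HasDerivAt (fun t => ∑ π : S, x.s π t) (∑ π : S, deriv (x.s π) u) u :=
    HasDerivAt.fun_sum fun π _ => (hr.s π).hasDerivAt
  refine h1.unique ((hasDerivAt_id u).congr_of_eventuallyEq ?_)
  filter_upwards [horizon_mem_nhds hu huT] with t ht using hx.busy t ht

theorem hasDerivAt_queue (hx : IsFluidSolution S R f l T x) (hu : 0 < u) (huT : (u : EReal) < T)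
    (hr : x.IsRegular u) (n : Fin N) :
    HasDerivAt (fun t => x.q t n)
      (l n - ((1 - Rᵀ) *ᵥ x.outputRate u) n) u := by
  have h1 : HasDerivAt (fun t => x.q 0 n + t * l n - (x.output t n - ∑ m, R m n * x.output t m))
      (0 + 1 * l n - (x.outputRate u n - ∑ m, R m n * x.outputRate u m)) u :=
    ((hasDerivAt_const u _).add ((hasDerivAt_id u).mul_const _)).sub
      ((hr.hasDerivAt_output n).sub
        (HasDerivAt.fun_sum fun m _ => (hr.hasDerivAt_output m).const_mul _))
  rw [one_sub_transpose_mulVec_apply]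
  rw [zero_add, one_mul] at h1
  refine h1.congr_of_eventuallyEq ?_
  filter_upwards [horizon_mem_nhds hu huT] with t ht
  rw [hx.queue_eq ht, Pi.sub_apply, one_sub_transpose_mulVec_apply]
  simp

theorem queue_deriv_eq_zero (hx : IsFluidSolution S R f l T x) (hu : 0 < u)
    (huT : (u : EReal) < T) {n : Fin N} (hn : x.q u n = 0) : deriv (fun t => x.q t n) u = 0 := by
  refine IsLocalMin.deriv_eq_zero ?_
  filter_upwards [horizon_mem_nhds hu huT] with t ht
  rw [hn]
  exact hx.q_nonneg t ht n

theorem mem_horizon (hu : 0 < u) (huT : (u : EReal) < T) : u ∈ horizon T :=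
  mem_of_mem_nhds (horizon_mem_nhds hu huT)

/-- A nonempty queue does not idle. An empty one has zero queue derivative, so its output equals its
inflow, which is nonnegative by induction from upstream. -/
theorem output_deriv_nonneg (h : IsNetwork S R f l) (hx : IsFluidSolution S R f l T x)
    (hu : 0 < u) (huT : (u : EReal) < T) (hr : x.IsRegular u) (n : Fin N) :
    0 ≤ x.outputRate u n := by
  induction n using h.routing.upstream_induction with
  | _ n ih =>
    rcases eq_or_lt_of_le (hx.q_nonneg u (mem_horizon hu huT) n) with h0 | h0
    · have h1 := (hx.hasDerivAt_queue hu huT hr n).deriv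
      rw [hx.queue_deriv_eq_zero hu huT h0.symm, one_sub_transpose_mulVec_apply] at h1
      have h2 : 0 ≤ ∑ m, R m n * x.outputRate u m :=
        Finset.sum_nonneg fun m _ => by
          rcases h.routing.zero_or_one m n with h3 | h3
          · simp [h3]
          · exact mul_nonneg (h.routing.entry_nonneg m n) (ih m h3)
      have h3 : 0 ≤ l n := h.rate_nonneg n
      linarith
    · rw [FluidPath.outputRate_apply, hx.idling u hu huT hr n h0, sub_zero, FluidPath.rate_apply]
      exact Finset.sum_nonneg fun π _ =>
        mul_nonneg (hx.s_deriv_nonneg hu huT π) (h.sched_nonneg π π.2 n)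

theorem le_rate_dotProduct (hx : IsFluidSolution S R f l T x) (hu : 0 < u)
    (huT : (u : EReal) < T) (hr : x.IsRegular u) {ρ : Fin N → ℝ} (hρ : ρ ∈ S) :
    ρ ⬝ᵥ pressure R f (x.q u) ≤ x.rate u ⬝ᵥ pressure R f (x.q u) := by
  rw [FluidPath.rate, sum_smul_dotProduct, ← one_mul (ρ ⬝ᵥ _), ← hx.sum_s_deriv hu huT hr,
    Finset.sum_mul]
  refine Finset.sum_le_sum fun π _ => ?_
  by_cases hπ : ρ ⬝ᵥ pressure R f (x.q u) ≤ (π : Fin N → ℝ) ⬝ᵥ pressure R f (x.q u)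
  · exact mul_le_mul_of_nonneg_left hπ (hx.s_deriv_nonneg hu huT π)
  · rw [hx.max_weight u hu huT hr π ⟨ρ, hρ, not_le.1 hπ⟩, zero_mul, zero_mul]

/-- The derivative is (λ̃ - output rate) paired with the pressure. The schedules in use have maximal
weight, and idling occurs only at empty queues, where the pressure is nonpositive. -/
theorem exists_deriv_energy (h : IsNetwork S R f l) (hx : IsFluidSolution S R f l T x)
    (hu : 0 < u) (huT : (u : EReal) < T) (hr : x.IsRegular u) {ρ : Fin N → ℝ} (hρ : ρ ∈ S) :
    ∃ e, HasDerivAt (fun t => energy f (x.q t)) e u ∧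
      e ≤ through R l ⬝ᵥ pressure R f (x.q u) - ρ ⬝ᵥ pressure R f (x.q u) := by
  have hq := hx.q_nonneg u (mem_horizon hu huT)
  set z : Fin N → ℝ := fun m => deriv (fun t => x.y t m) u with hz
  refine ⟨(fun n => f (x.q u n)) ⬝ᵥ (l - (1 - Rᵀ) *ᵥ x.outputRate u), ?_, ?_⟩
  · refine HasDerivAt.fun_sum fun n _ => ?_
    have h1 := h.weight.hasDerivAt_potential (x.q u n)
    rw [max_eq_left (show (0 : ℝ) ≤ x.q u n from hq n)] at h1
    exact h1.comp u (hx.hasDerivAt_queue hu huT hr n)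
  · rw [h.routing.weights_dotProduct, through_sub, h.routing.through_mulVec, sub_dotProduct,
      FluidPath.outputRate, sub_dotProduct]
    have h1 := hx.le_rate_dotProduct hu huT hr hρ
    have h2 : z ⬝ᵥ pressure R f (x.q u) ≤ 0 := by
      refine Finset.sum_nonpos fun n _ => ?_
      rcases eq_or_lt_of_le (hq n) with h0 | h0
      · exact mul_nonpos_of_nonneg_of_nonpos (hx.y_deriv_nonneg hu huT n)
          (h.pressure_nonpos hq h0.symm)
      · simp only [hz]
        rw [hx.idling u hu huT hr n h0, zero_mul]
    linarith

end Rates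

/-- The energy decreases at least at rate `δ` while some schedule outweighs the offered work
by `δ`. -/
theorem energy_add_le (h : IsNetwork S R f l) (hx : IsFluidSolution S R f l T x) {a b δ : ℝ}
    (ha : 0 ≤ a) (hab : a ≤ b) (hb : b ∈ horizon T)
    (hδ : ∀ u ∈ Set.Ioo a b, ∃ ρ ∈ S,
      through R l ⬝ᵥ pressure R f (x.q u) + δ ≤ ρ ⬝ᵥ pressure R f (x.q u)) :
    energy f (x.q b) + δ * (b - a) ≤ energy f (x.q a) := by
  have hac0 : AbsolutelyContinuousOnInterval (fun t => energy f (x.q t) + δ * t) 0 b :=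
    (AbsolutelyContinuousOnInterval.sum _ fun n _ =>
      h.weight.absolutelyContinuous_potential (hx.q_abs_cont n b hb)).fun_add
      (AbsolutelyContinuousOnInterval.linear δ 0 b)
  have hac : AbsolutelyContinuousOnInterval (fun t => energy f (x.q t) + δ * t) a b := by
    refine hac0.mono ?_
    rw [Set.uIcc_of_le hab, Set.uIcc_of_le hb.1]
    exact Set.Icc_subset_Icc_left ha
  have := hac.le_of_ae_deriv_nonpos hab ?_
  · linarith
  · filter_upwards [hx.ae_isRegular hb] with u hreg hu
    have hu0 : 0 < u := ha.trans_lt hu.1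
    have huT := lt_of_lt_mem_horizon hb hu.2
    obtain ⟨ρ, hρ, hle⟩ := hδ u hu
    obtain ⟨e, he, hle'⟩ := hx.exists_deriv_energy h hu0 huT (hreg ⟨hu0, hu.2⟩) hρ
    rw [(he.fun_add ((hasDerivAt_id' u).const_mul δ)).deriv]
    linarith

theorem energy_le (h : IsNetwork S R f l) (hx : IsFluidSolution S R f l T x) {a b : ℝ}
    (ha : 0 ≤ a) (hab : a ≤ b) (hb : b ∈ horizon T) : energy f (x.q b) ≤ energy f (x.q a) := by
  have := hx.energy_add_le h (δ := 0) ha hab hb fun u _ => by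
    obtain ⟨ρ, hρ, hmax⟩ := S.exists_max_image (fun ρ => ρ ⬝ᵥ pressure R f (x.q u)) h.nonempty
    exact ⟨ρ, hρ, by rw [add_zero]; exact h.rate_dotProduct_le hmax⟩
  simpa using this

theorem output_mono (h : IsNetwork S R f l) (hx : IsFluidSolution S R f l T x) {a b : ℝ}
    (ha : 0 ≤ a) (hab : a ≤ b) (hb : b ∈ horizon T) : x.output a ≤ x.output b := by
  intro n
  have hac : AbsolutelyContinuousOnInterval (fun t => - x.output t n) a b := by
    refine (hx.output_abs_cont hb n).fun_neg.mono ?_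
    rw [Set.uIcc_of_le hab, Set.uIcc_of_le hb.1]
    exact Set.Icc_subset_Icc_left ha
  have := hac.le_of_ae_deriv_nonpos hab ?_
  · linarith
  · filter_upwards [hx.ae_isRegular hb] with u hreg hu
    have hu0 : 0 < u := ha.trans_lt hu.1
    have hr := hreg ⟨hu0, hu.2⟩
    rw [(hr.hasDerivAt_output n).fun_neg.deriv]
    linarith [hx.output_deriv_nonneg h hu0 (lt_of_lt_mem_horizon hb hu.2) hr n]

/-- Later states of a fluid model solution are feasible for the optimization problem of an
earlier state. -/
theorem isFeasible (h : IsNetwork S R f l) (hx : IsFluidSolution S R f l T x) {a b : ℝ}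
    (ha : 0 ≤ a) (hab : a ≤ b) (hb : b ∈ horizon T) : IsFeasible S R l (x.q a) (x.q b) := by
  have haT := mem_horizon_of_le hb ha hab
  have hqa := hx.through_queue h.routing haT
  have hqb := hx.through_queue h.routing hb
  refine ⟨hx.q_nonneg b hb, fun ξ hξ => ?_, fun n hn => ?_⟩
  · rw [hqa, hqb]
    simp only [dotProduct_add, dotProduct_sub, dotProduct_smul, hξ.2, smul_eq_mul, mul_one]
    have hy : 0 ≤ ξ ⬝ᵥ (x.y b - x.y a) :=
      dotProduct_nonneg_of_nonneg hξ.1.1.1.1 (sub_nonneg.2 fun n => hx.y_mono n haT hb hab)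
    have hs : ξ ⬝ᵥ (x.service b - x.service a) ≤ b - a := by
      rw [FluidPath.service, FluidPath.service, ← Finset.sum_sub_distrib, dotProduct_comm]
      simp_rw [← sub_smul]
      have hba : b - a = ∑ π : S, (x.s π b - x.s π a) := by
        rw [Finset.sum_sub_distrib, hx.busy b hb, hx.busy a haT]
      rw [sum_smul_dotProduct, hba]
      refine Finset.sum_le_sum fun π _ => mul_le_of_le_one_right
        (sub_nonneg.2 (hx.s_mono π haT hb hab)) ?_
      rw [dotProduct_comm]
      exact hξ.1.1.1.2 π π.2
    simp only [FluidPath.output, dotProduct_sub] at *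
    linarith
  · rw [hqa, hqb]
    have := hx.output_mono h ha hab hb n
    simp only [Pi.add_apply, Pi.sub_apply, Pi.smul_apply, hn, smul_zero]
    linarith

theorem eq_of_isBalanced (h : IsNetwork S R f l) (hT : 0 < T) (hx : IsFluidSolution S R f l T x)
    (h0 : x.q 0 = liftingMap S R f l (x.q 0)) {t : ℝ} (ht : t ∈ horizon T) : x.q t = x.q 0 := by
  have hq := hx.q_nonneg 0 (zero_mem_horizon hT)
  conv_rhs => rw [h0]
  refine h.eq_liftingMap_of_energy_le hq (hx.isFeasible h le_rfl ht.1 ht) ?_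
  rw [← h0]
  exact hx.energy_le h le_rfl ht.1 ht

/-- The state of a constant fluid model solution is balanced. -/
theorem isBalanced_of_const (h : IsNetwork S R f l) (hT : 0 < T)
    (hx : IsFluidSolution S R f l T x) (hc : ∀ t ∈ horizon T, x.q t = x.q 0) :
    IsBalanced S R f l (x.q 0) := by
  intro ρ hρ
  obtain ⟨b, hb0, hbT⟩ := EReal.lt_iff_exists_real_btwn.1 hT
  have hb0 : 0 < b := by exact_mod_cast hb0
  by_contra hlt
  rw [not_le] at hlt
  have := hx.energy_add_le h (δ := ρ ⬝ᵥ pressure R f (x.q 0) - through R l ⬝ᵥ pressure R f (x.q 0))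
    le_rfl hb0.le (mem_horizon hb0 hbT) fun u hu => ⟨ρ, hρ, by
      rw [hc u (mem_horizon_of_le (mem_horizon hb0 hbT) hu.1.le hu.2.le)]; linarith⟩
  rw [hc b (mem_horizon hb0 hbT)] at this
  nlinarith

end IsFluidSolution

/-! ### Convergence to the invariant manifold -/

theorem IsNetwork.continuousOn_excess (h : IsNetwork S R f l) :
    ContinuousOn (fun q => energy f q - energy f (liftingMap S R f l q)) {q | 0 ≤ q} :=
  h.weight.continuous_energy.continuousOn.sub
    (h.weight.continuous_energy.comp_continuousOn h.continuousOn_liftingMap)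

theorem IsNetwork.excess_pos (h : IsNetwork S R f l) {q : Fin N → ℝ} (hq : 0 ≤ q)
    (hne : q ≠ liftingMap S R f l q) : 0 < energy f q - energy f (liftingMap S R f l q) := by
  by_contra hle
  exact hne (h.eq_liftingMap_of_energy_le hq (IsFeasible.refl hq) (by linarith))

theorem IsWeightFunction.continuousOn_pressure (hf : IsWeightFunction S R f) :
    ContinuousOn (pressure R f) {q : Fin N → ℝ | 0 ≤ q} := by
  refine (Continuous.matrix_mulVec continuous_const continuous_id).comp_continuousOn ?_
  exact continuousOn_pi.2 fun n => hf.continuousOn.comp (continuous_apply n).continuousOn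
    fun q hq => hq n

/-- Away from the balanced states, the excess weight of the best schedule is bounded below on
compact sets. -/
theorem IsNetwork.exists_gap (h : IsNetwork S R f l) {X : Set (Fin N → ℝ)} (hX : IsCompact X)
    (hX0 : ∀ q ∈ X, 0 ≤ q) (hb : ∀ q ∈ X, ¬ IsBalanced S R f l q) :
    ∃ δ > 0, ∀ q ∈ X, ∃ ρ ∈ S,
      through R l ⬝ᵥ pressure R f q + δ ≤ ρ ⬝ᵥ pressure R f q := by
  rcases X.eq_empty_or_nonempty with rfl | hne
  · exact ⟨1, one_pos, by simp⟩
  have hcp : ContinuousOn (pressure R f) X := h.weight.continuousOn_pressure.mono hX0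
  have hdot : ∀ ρ : Fin N → ℝ, ContinuousOn (fun q => ρ ⬝ᵥ pressure R f q) X := fun ρ =>
    (Continuous.dotProduct continuous_const continuous_id :
      Continuous fun w : Fin N → ℝ => ρ ⬝ᵥ w).comp_continuousOn hcp
  -- The best excess weight is continuous and positive at each unbalanced state, so its minimum over
  -- X serves as δ.
  have hcont : ContinuousOn (fun q => S.sup' h.nonempty fun ρ =>
      ρ ⬝ᵥ pressure R f q - through R l ⬝ᵥ pressure R f q) X :=
    ContinuousOn.finset_sup'_apply h.nonempty fun ρ _ => (hdot ρ).sub (hdot _)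
  obtain ⟨q₀, hq₀, hmin⟩ := hX.exists_isMinOn hne hcont
  refine ⟨S.sup' h.nonempty fun ρ =>
    ρ ⬝ᵥ pressure R f q₀ - through R l ⬝ᵥ pressure R f q₀, ?_, fun q hq => ?_⟩
  rotate_left
  · obtain ⟨ρ, hρ, he⟩ := S.exists_mem_eq_sup' h.nonempty fun ρ =>
      ρ ⬝ᵥ pressure R f q - through R l ⬝ᵥ pressure R f q
    refine ⟨ρ, hρ, ?_⟩
    have := hmin hq
    simp only [Set.mem_ofPred_eq] at this
    rw [he] at this
    linarith
  · have := hb q₀ hq₀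
    rw [IsBalanced] at this
    push Not at this
    obtain ⟨ρ, hρ, hlt⟩ := this
    rw [gt_iff_lt, Finset.lt_sup'_iff]
    exact ⟨ρ, hρ, sub_pos.2 hlt⟩

/-- The excess is continuous and positive on the compact set of states at distance at least ε from
their lift; η is its minimum there. -/
theorem IsNetwork.exists_excess_bound (h : IsNetwork S R f l) (K : ℝ) {ε : ℝ} (hε : 0 < ε) :
    ∃ η > 0, ∀ q : Fin N → ℝ, 0 ≤ q → energy f q ≤ K →
      energy f q - energy f (liftingMap S R f l q) < η → ‖q - liftingMap S R f l q‖ < ε := by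
  set X₀ : Set (Fin N → ℝ) := {q | 0 ≤ q ∧ energy f q ≤ K}
  have hX₀ : IsCompact X₀ := h.weight.isCompact_sublevel K
  have hc : ContinuousOn (fun q => ‖q - liftingMap S R f l q‖) X₀ :=
    (continuousOn_id.sub (h.continuousOn_liftingMap.mono fun q hq => hq.1)).norm
  have hX : IsCompact (X₀ ∩ (fun q => ‖q - liftingMap S R f l q‖) ⁻¹' Set.Ici ε) :=
    hX₀.of_isClosed_subset (hc.preimage_isClosed_of_isClosed hX₀.isClosed isClosed_Ici)
      Set.inter_subset_left
  rcases Set.eq_empty_or_nonempty (X₀ ∩ (fun q => ‖q - liftingMap S R f l q‖) ⁻¹' Set.Ici ε)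
    with he | hne
  · refine ⟨1, one_pos, fun q hq hK _ => ?_⟩
    by_contra hle
    have : q ∈ (∅ : Set (Fin N → ℝ)) := he ▸ ⟨⟨hq, hK⟩, not_lt.1 hle⟩
    exact this
  obtain ⟨q₀, hq₀, hmin⟩ := hX.exists_isMinOn hne
    (h.continuousOn_excess.mono fun q hq => hq.1.1)
  refine ⟨_, h.excess_pos hq₀.1.1 fun he => ?_, fun q hq hK hlt => ?_⟩
  · have h1 : ε ≤ ‖q₀ - liftingMap S R f l q₀‖ := hq₀.2
    rw [← he, sub_self, norm_zero] at h1
    linarith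
  · by_contra hle
    exact absurd (hmin ⟨⟨hq, hK⟩, not_lt.1 hle⟩) (not_le.2 hlt)

/-- The excess never increases, so if it is at least η at time t it was so throughout, and L fell at
rate δ all along. As L starts below K and stays nonnegative, t ≤ K / δ. -/
theorem IsNetwork.exists_uniform_time (h : IsNetwork S R f l) {ε : ℝ} (hε : 0 < ε) :
    ∃ H : ℝ, ∀ T : EReal, 0 < T → ∀ x : FluidPath S, IsFluidSolution S R f l T x → ‖x.q 0‖ ≤ 1 →
      ∀ t ∈ horizon T, H ≤ t → ‖x.q t - liftingMap S R f l (x.q t)‖ < ε := by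
  obtain ⟨K, hK⟩ := (isCompact_closedBall (0 : Fin N → ℝ) 1).bddAbove_image
    (f := energy f) h.weight.continuous_energy.continuousOn
  obtain ⟨η, hη, hηε⟩ := h.exists_excess_bound K hε
  set X₀ : Set (Fin N → ℝ) := {q | 0 ≤ q ∧ energy f q ≤ K}
  have hX₀ : IsCompact X₀ := h.weight.isCompact_sublevel K
  have hX : IsCompact (X₀ ∩
      (fun q => energy f q - energy f (liftingMap S R f l q)) ⁻¹' Set.Ici η) :=
    hX₀.of_isClosed_subset ((h.continuousOn_excess.mono fun q hq =>
      hq.1).preimage_isClosed_of_isClosed hX₀.isClosed isClosed_Ici) Set.inter_subset_left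
  obtain ⟨δ, hδ, hgap⟩ := h.exists_gap hX (fun q hq => hq.1.1) fun q hq hb => by
    have h1 : η ≤ energy f q - energy f (liftingMap S R f l q) := hq.2
    rw [← (h.eq_liftingMap_iff_isBalanced hq.1.1).2 hb, sub_self] at h1
    linarith
  refine ⟨K / δ + 1, fun T hT x hx hx0 t ht hHt => ?_⟩
  have hq0K : energy f (x.q 0) ≤ K :=
    hK ⟨x.q 0, by simpa using hx0, rfl⟩
  have hmem : ∀ u, 0 ≤ u → u ≤ t → 0 ≤ x.q u ∧ energy f (x.q u) ≤ K := fun u hu hut =>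
    have huT := mem_horizon_of_le ht hu hut
    ⟨hx.q_nonneg u huT, (hx.energy_le h le_rfl hu huT).trans hq0K⟩
  refine hηε _ (hmem t ht.1 le_rfl).1 (hmem t ht.1 le_rfl).2 ?_
  by_contra hlt
  rw [not_lt] at hlt
  have hbig : ∀ u ∈ Set.Ioo 0 t,
      η ≤ energy f (x.q u) - energy f (liftingMap S R f l (x.q u)) := by
    intro u hu
    have h1 := hx.energy_le h hu.1.le hu.2.le ht
    -- The lift of the later state is feasible for the earlier one, so the minimal energy can only
    -- grow in time.
    have h2 := h.energy_liftingMap_le (hmem u hu.1.le hu.2.le).1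
      ((hx.isFeasible h hu.1.le hu.2.le ht).trans (h.liftingMap_spec (hmem t ht.1 le_rfl).1).1)
    linarith
  have h3 := hx.energy_add_le h (δ := δ) le_rfl ht.1 ht fun u hu =>
    hgap _ ⟨hmem u hu.1.le hu.2.le, hbig u hu⟩
  have h4 := h.weight.energy_nonneg (x.q t)
  have h5 : K / δ < t - 0 := by linarith
  rw [div_lt_iff₀ hδ] at h5
  linarith

/-! ### Existence of fluid model solutions, by an Euler scheme -/

/-- The state at time `t` if each schedule `π` has been used for time `u π` without idling. -/
def stateAt (R : Matrix (Fin N) (Fin N) ℝ) (l q₀ : Fin N → ℝ) (u : S → ℝ) (t : ℝ) : Fin N → ℝ :=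
  q₀ + t • l - (1 - Rᵀ) *ᵥ ∑ π : S, u π • (π : Fin N → ℝ)

/-- The time spent on each schedule after `k` steps of length `h` of the Euler scheme, where the
schedule for each step is selected by `sel` from the state at its beginning. -/
def usage (R : Matrix (Fin N) (Fin N) ℝ) (l q₀ : Fin N → ℝ) (sel : (Fin N → ℝ) → S) (h : ℝ) :
    ℕ → S → ℝ
  | 0 => 0
  | k + 1 => usage R l q₀ sel h k +
      Pi.single (sel (stateAt R l q₀ (usage R l q₀ sel h k) (k * h))) h

theorem continuous_stateAt (q₀ : Fin N → ℝ) :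
    Continuous fun p : (S → ℝ) × ℝ => stateAt R l q₀ p.1 p.2 := by
  unfold stateAt
  refine Continuous.sub (by fun_prop) (Continuous.matrix_mulVec continuous_const ?_)
  exact continuous_finsetSum _ fun π _ =>
    ((continuous_apply π).comp continuous_fst).smul continuous_const

/-- Schedules of maximal weight can be chosen not to serve empty queues. -/
theorem IsNetwork.exists_maximizer (h : IsNetwork S R f l) (p : Fin N → ℝ) :
    ∃ π : S, (∀ ρ ∈ S, ρ ⬝ᵥ pressure R f (fun n => max (p n) 0) ≤
        (π : Fin N → ℝ) ⬝ᵥ pressure R f (fun n => max (p n) 0)) ∧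
      ∀ n, p n ≤ 0 → (π : Fin N → ℝ) n = 0 := by
  -- Euler states may dip below zero, so pressures are evaluated at their positive part.
  set q : Fin N → ℝ := fun n => max (p n) 0
  have hq : 0 ≤ q := fun n => le_max_right _ _
  obtain ⟨ρ, hρ, hmax⟩ := S.exists_max_image (fun ρ => ρ ⬝ᵥ pressure R f q) h.nonempty
  refine ⟨⟨_, h.monotone.trim_mem hρ fun n => 0 < p n⟩, fun ρ' hρ' => (hmax ρ' hρ').trans ?_,
    fun n hn => by simp [not_lt.2 hn]⟩
  refine Finset.sum_le_sum fun n _ => ?_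
  by_cases hn : 0 < p n
  · simp [hn]
  · simp only [hn, if_false, zero_mul]
    exact mul_nonpos_of_nonneg_of_nonpos (h.sched_nonneg ρ hρ n)
      (h.pressure_nonpos hq (max_eq_right (not_lt.1 hn)))

/-! ### Estimates for the Euler scheme -/

section Euler

variable {q₀ : Fin N → ℝ} {sel : (Fin N → ℝ) → S} {h : ℝ}

theorem usage_succ_of_ne {k : ℕ} {π : S}
    (hne : sel (stateAt R l q₀ (usage R l q₀ sel h k) (k * h)) ≠ π) :
    usage R l q₀ sel h (k + 1) π = usage R l q₀ sel h k π := by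
  simp [usage, Pi.single_eq_of_ne hne.symm]

theorem usage_le_succ (hh : 0 ≤ h) (k : ℕ) (π : S) :
    usage R l q₀ sel h k π ≤ usage R l q₀ sel h (k + 1) π ∧
      usage R l q₀ sel h (k + 1) π ≤ usage R l q₀ sel h k π + h := by
  by_cases hne : sel (stateAt R l q₀ (usage R l q₀ sel h k) (k * h)) = π
  · subst hne
    simp [usage, hh]
  · rw [usage_succ_of_ne hne]
    exact ⟨le_rfl, by linarith⟩

theorem usage_mono (hh : 0 ≤ h) (π : S) : Monotone fun k => usage R l q₀ sel h k π :=
  monotone_nat_of_le_succ fun k => (usage_le_succ hh k π).1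

theorem usage_le_add (hh : 0 ≤ h) {i j : ℕ} (hij : i ≤ j) (π : S) :
    usage R l q₀ sel h j π ≤ usage R l q₀ sel h i π + (j * h - i * h) := by
  induction j, hij using Nat.le_induction with
  | base => simp
  | succ j hij ih =>
    have := (usage_le_succ (R := R) (l := l) (q₀ := q₀) (sel := sel) hh j π).2
    push_cast
    linarith

theorem abs_usage_sub_le (hh : 0 ≤ h) (i j : ℕ) (π : S) :
    |usage R l q₀ sel h j π - usage R l q₀ sel h i π| ≤ |j * h - i * h| := by
  wlog hij : i ≤ j generalizing i j
  · rw [abs_sub_comm, abs_sub_comm (j * h)]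
    exact this j i (le_of_not_ge hij)
  have h1 := usage_mono (R := R) (l := l) (q₀ := q₀) (sel := sel) hh π hij
  have h2 := usage_le_add (R := R) (l := l) (q₀ := q₀) (sel := sel) hh hij π
  simp only at h1
  rw [abs_of_nonneg (sub_nonneg.2 h1)]
  exact le_trans (by linarith) (le_abs_self _)

theorem usage_nonneg (hh : 0 ≤ h) (k : ℕ) (π : S) : 0 ≤ usage R l q₀ sel h k π :=
  usage_mono hh π (Nat.zero_le k)

theorem usage_le (hh : 0 ≤ h) (k : ℕ) (π : S) : usage R l q₀ sel h k π ≤ k * h := by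
  have := usage_le_add (R := R) (l := l) (q₀ := q₀) (sel := sel) hh (Nat.zero_le k) π
  simpa [usage] using this

theorem sum_usage (k : ℕ) : ∑ π : S, usage R l q₀ sel h k π = k * h := by
  induction k with
  | zero => simp [usage]
  | succ k ih =>
    simp only [usage, Pi.add_apply, Finset.sum_add_distrib, ih, Finset.sum_pi_single',
      Finset.mem_univ, if_true]
    push_cast
    ring

theorem stateAt_usage_succ (k : ℕ) :
    stateAt R l q₀ (usage R l q₀ sel h (k + 1)) ((k + 1 : ℕ) * h) =
      stateAt R l q₀ (usage R l q₀ sel h k) (k * h) + h • (l - (1 - Rᵀ) *ᵥ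
        (sel (stateAt R l q₀ (usage R l q₀ sel h k) (k * h)) : Fin N → ℝ)) := by
  set π₀ := sel (stateAt R l q₀ (usage R l q₀ sel h k) (k * h)) with hπ₀
  have h1 : ∑ π : S, usage R l q₀ sel h (k + 1) π • (π : Fin N → ℝ) =
      ∑ π : S, usage R l q₀ sel h k π • (π : Fin N → ℝ) + h • (π₀ : Fin N → ℝ) := by
    simp only [usage, ← hπ₀, Pi.add_apply, add_smul, Finset.sum_add_distrib]
    congr 1
    rw [Finset.sum_eq_single π₀]
    · rw [Pi.single_eq_same]
    · intro π _ hne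
      rw [Pi.single_eq_of_ne hne, zero_smul]
    · simp
  rw [stateAt, stateAt, h1, Matrix.mulVec_add, Matrix.mulVec_smul, smul_sub]
  push_cast
  rw [add_mul, one_mul, add_smul]
  abel

/-- A queue at or below zero is not served, so it can only rise; a positive one loses at most one
step of service. -/
theorem neg_le_stateAt_usage (hR : IsAcyclicRouting R) (hS : ∀ π ∈ S, 0 ≤ π) (hl : 0 ≤ l)
    (hq₀ : 0 ≤ q₀) (hsel : ∀ p n, p n ≤ 0 → (sel p : Fin N → ℝ) n = 0) (hh : 0 ≤ h) {B : ℝ}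
    (hB0 : 0 ≤ B) (hB : ∀ π ∈ S, ∀ n, π n ≤ B) (k : ℕ) (n : Fin N) :
    -(h * B) ≤ stateAt R l q₀ (usage R l q₀ sel h k) (k * h) n := by
  induction k with
  | zero =>
    have : 0 ≤ q₀ n := hq₀ n
    have h1 := mul_nonneg hh hB0
    simp [stateAt, usage]
    linarith
  | succ k ih =>
    rw [stateAt_usage_succ]
    set p := stateAt R l q₀ (usage R l q₀ sel h k) (k * h)
    rw [Pi.add_apply, Pi.smul_apply, Pi.sub_apply, one_sub_transpose_mulVec_apply, smul_eq_mul]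
    have h2 : 0 ≤ ∑ m, R m n * (sel p : Fin N → ℝ) m := Finset.sum_nonneg fun m _ =>
      mul_nonneg (hR.entry_nonneg m n) (hS _ (sel p).2 m)
    have h3 : 0 ≤ l n := hl n
    have h4 := mul_nonneg hh (add_nonneg h3 h2)
    rcases le_or_gt (p n) 0 with hn | hn
    · rw [hsel p n hn]
      linarith
    · have h5 := mul_le_mul_of_nonneg_left (hB _ (sel p).2 n) hh
      linarith

/-- A schedule is not used as long as the state stays in a region where it is not selected. -/
theorem usage_eq_of_forall_ne {i j : ℕ} (hij : i ≤ j) {π : S}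
    (hne : ∀ k, i ≤ k → k < j → sel (stateAt R l q₀ (usage R l q₀ sel h k) (k * h)) ≠ π) :
    usage R l q₀ sel h j π = usage R l q₀ sel h i π := by
  induction j, hij using Nat.le_induction with
  | base => rfl
  | succ j hij ih =>
    rw [usage_succ_of_ne (hne j hij (Nat.lt_succ_self j))]
    exact ih fun k hik hkj => hne k hik (hkj.trans (Nat.lt_succ_self j))

end Euler

/-- The Euler grid of mesh `1 / (k + 1)`: the index of the last grid point before `t`. -/
def gridIndex (k : ℕ) (t : ℝ) : ℕ := ⌊t * (k + 1)⌋₊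

theorem gridIndex_mono (k : ℕ) : Monotone (gridIndex k) := fun a b hab =>
  Nat.floor_mono (mul_le_mul_of_nonneg_right hab (by positivity))

theorem gridIndex_mul_le (k : ℕ) {t : ℝ} (ht : 0 ≤ t) : gridIndex k t * (1 / (k + 1 : ℝ)) ≤ t := by
  rw [mul_one_div, div_le_iff₀ (by positivity)]
  exact Nat.floor_le (by positivity)

theorem lt_gridIndex_mul (k : ℕ) (t : ℝ) :
    t - 1 / (k + 1 : ℝ) < gridIndex k t * (1 / (k + 1 : ℝ)) := by
  rw [mul_one_div, lt_div_iff₀ (by positivity), sub_mul, one_div,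
    inv_mul_cancel₀ (by positivity : (k + 1 : ℝ) ≠ 0)]
  linarith [Nat.lt_floor_add_one (t * (k + 1 : ℝ)), show (gridIndex k t : ℝ) =
    (⌊t * (k + 1 : ℝ)⌋₊ : ℝ) from rfl]

theorem tendsto_gridIndex {t : ℝ} (ht : 0 ≤ t) :
    Tendsto (fun k : ℕ => gridIndex k t * (1 / (k + 1 : ℝ))) atTop (𝓝 t) := by
  have h1 : Tendsto (fun k : ℕ => t - 1 / (k + 1 : ℝ)) atTop (𝓝 t) := by
    simpa using tendsto_const_nhds.sub (tendsto_one_div_add_atTop_nhds_zero_nat (𝕜 := ℝ))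
  exact tendsto_of_tendsto_of_tendsto_of_le_of_le h1 tendsto_const_nhds
    (fun k => (lt_gridIndex_mul k t).le) fun k => gridIndex_mul_le k ht

/-- Limits of the Euler scheme: the schedule usage of a fluid model solution without idling. -/
theorem IsNetwork.exists_usage (hN : IsNetwork S R f l) {q₀ : Fin N → ℝ} (hq₀ : 0 ≤ q₀) :
    ∃ s : ℝ → S → ℝ, (∀ a b, 0 ≤ a → a ≤ b → ∀ π, s a π ≤ s b π ∧ s b π ≤ s a π + (b - a)) ∧
      (∀ π, s 0 π = 0) ∧
      (∀ t, 0 ≤ t → ∑ π, s t π = t) ∧ (∀ t, 0 ≤ t → 0 ≤ stateAt R l q₀ (s t) t) ∧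
      ∀ t, 0 < t → ∀ π : S, (∃ ρ ∈ S, (π : Fin N → ℝ) ⬝ᵥ pressure R f (stateAt R l q₀ (s t) t) <
        ρ ⬝ᵥ pressure R f (stateAt R l q₀ (s t) t)) → ∀ᶠ t' in 𝓝 t, s t' π = s t π := by
  choose sel hmax hsel using hN.exists_maximizer
  -- An ultrafilter limit exists for all times and schedules at once, so no subsequence has to be
  -- chosen.
  let U : Ultrafilter ℕ := hyperfilter ℕ
  have hU : (U : Filter ℕ) ≤ atTop := Nat.hyperfilter_le_atTop
  let d : ℕ → ℝ := fun k => 1 / (k + 1 : ℝ)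
  have hd : ∀ k, 0 ≤ d k := fun k => by positivity
  have hd0 : Tendsto d U (𝓝 0) := (tendsto_one_div_add_atTop_nhds_zero_nat (𝕜 := ℝ)).mono_left hU
  let e : ℕ → ℝ → S → ℝ := fun k t => usage R l q₀ sel (d k) (gridIndex k t)
  have hlim : ∀ t π, ∃ v, 0 ≤ t → Tendsto (fun k => e k t π) U (𝓝 v) := by
    intro t π
    by_cases ht : 0 ≤ t
    · have hmem : ∀ k, e k t π ∈ Set.Icc 0 t := fun k =>
        ⟨usage_nonneg (hd k) _ π, (usage_le (hd k) _ π).trans (gridIndex_mul_le k ht)⟩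
      obtain ⟨v, -, hv⟩ := (isCompact_Icc (a := (0 : ℝ)) (b := t)).ultrafilter_le_nhds
        (U.map fun k => e k t π) (le_principal_iff.2 (mem_map.2 (univ_mem' hmem)))
      exact ⟨v, fun _ => hv⟩
    · exact ⟨0, fun h => absurd h ht⟩
  choose s hs using hlim
  have hgrid : ∀ t, 0 ≤ t → Tendsto (fun k => gridIndex k t * d k) U (𝓝 t) := fun t ht =>
    (tendsto_gridIndex ht).mono_left hU
  have hpair : ∀ t, 0 ≤ t → Tendsto (fun k => ((e k t, gridIndex k t * d k) : (S → ℝ) × ℝ)) U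
      (𝓝 (s t, t)) := fun t ht =>
    (tendsto_pi_nhds.2 fun π => hs t π ht).prodMk_nhds (hgrid t ht)
  have hstate : ∀ t, 0 ≤ t → Tendsto (fun k => stateAt R l q₀ (e k t) (gridIndex k t * d k)) U
      (𝓝 (stateAt R l q₀ (s t) t)) := fun t ht =>
    ((continuous_stateAt q₀).tendsto (s t, t)).comp (hpair t ht)
  have hnonneg : ∀ t, 0 ≤ t → 0 ≤ stateAt R l q₀ (s t) t := by
    intro t ht n
    set B := ∑ π ∈ S, ∑ n, π n with hBdef
    have hB0 : 0 ≤ B := Finset.sum_nonneg fun π hπ => Finset.sum_nonneg fun n _ =>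
      hN.sched_nonneg π hπ n
    have hB : ∀ π ∈ S, ∀ n, π n ≤ B := fun π hπ n =>
      (Finset.single_le_sum (f := fun n => π n) (fun m _ => hN.sched_nonneg π hπ m)
        (Finset.mem_univ n)).trans
      (Finset.single_le_sum (f := fun π : Fin N → ℝ => ∑ n, π n)
        (fun ρ hρ => Finset.sum_nonneg fun m _ => hN.sched_nonneg ρ hρ m) hπ)
    have h1 : Tendsto (fun k => -(d k * B)) U (𝓝 (-(0 * B))) := (hd0.mul_const B).neg
    rw [zero_mul, neg_zero] at h1
    exact le_of_tendsto_of_tendsto h1 (((continuous_apply n).tendsto _).comp (hstate t ht))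
      (Eventually.of_forall fun k => neg_le_stateAt_usage hN.routing hN.sched_nonneg
        hN.rate_nonneg hq₀ hsel (hd k) hB0 hB _ n)
  refine ⟨s, fun a b ha hab π => ⟨?_, ?_⟩, fun π => ?_, fun t ht => ?_, hnonneg, ?_⟩
  · exact le_of_tendsto_of_tendsto (hs a π ha) (hs b π (ha.trans hab))
      (Eventually.of_forall fun k => usage_mono (hd k) π (gridIndex_mono k hab))
  · exact le_of_tendsto_of_tendsto (hs b π (ha.trans hab))
      ((hs a π ha).add ((hgrid b (ha.trans hab)).sub (hgrid a ha)))
      (Eventually.of_forall fun k => usage_le_add (hd k) (gridIndex_mono k hab) π)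
  · refine tendsto_nhds_unique (hs 0 π le_rfl) ?_
    simp [e, gridIndex, usage]
  · refine tendsto_nhds_unique (tendsto_finsetSum _ fun π _ => hs t π ht) ?_
    simp only [e, sum_usage]
    exact hgrid t ht
  · rintro t ht π ⟨ρ, hρ, hlt⟩
    -- On V the schedule π is beaten by ρ, so the scheme never selects it there.
    let V : Set ((S → ℝ) × ℝ) := {p |
      (π : Fin N → ℝ) ⬝ᵥ pressure R f (fun n => max (stateAt R l q₀ p.1 p.2 n) 0) <
        ρ ⬝ᵥ pressure R f (fun n => max (stateAt R l q₀ p.1 p.2 n) 0)}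
    have hcont : ∀ v : Fin N → ℝ, Continuous fun p : (S → ℝ) × ℝ =>
        v ⬝ᵥ pressure R f (fun n => max (stateAt R l q₀ p.1 p.2 n) 0) := fun v =>
      Continuous.dotProduct continuous_const (Continuous.matrix_mulVec continuous_const
        (continuous_pi fun n => hN.weight.continuous_max.comp
          ((continuous_apply n).comp (continuous_stateAt q₀))))
    have hVo : IsOpen V := isOpen_lt (hcont _) (hcont _)
    have hVm : (s t, t) ∈ V := by
      have : (fun n => max (stateAt R l q₀ (s t) t n) 0) = stateAt R l q₀ (s t) t :=
        funext fun n => max_eq_left (hnonneg t ht.le n)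
      simpa only [V, Set.mem_ofPred_eq, this] using hlt
    obtain ⟨r, hr, hball⟩ := Metric.isOpen_iff.1 hVo _ hVm
    have hev : ∀ᶠ k in (U : Filter ℕ),
        dist ((e k t, gridIndex k t * d k) : (S → ℝ) × ℝ) (s t, t) < r / 2 ∧ d k < r / 4 :=
      ((hpair t ht.le).eventually (Metric.ball_mem_nhds _ (half_pos hr))).and
        (hd0.eventually (gt_mem_nhds (by linarith)))
    have hnear : ∀ k, dist ((e k t, gridIndex k t * d k) : (S → ℝ) × ℝ) (s t, t) < r / 2 →
        d k < r / 4 → ∀ a b, 0 ≤ a → a ≤ b → |a - t| < r / 4 → |b - t| < r / 4 →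
        e k b π = e k a π := by
      intro k hk1 hk2 a b ha hab hat hbt
      refine usage_eq_of_forall_ne (gridIndex_mono k hab) fun j haj hjb hj => ?_
      -- Grid points used between a and b lie within r/4 + r/4 of the one for t. Usage moves no
      -- faster than time, so the scheme stays in the ball of radius r inside V.
      have hdist : |j * d k - gridIndex k t * d k| < r / 2 := by
        have h1 : (gridIndex k a : ℝ) * d k ≤ j * d k :=
          mul_le_mul_of_nonneg_right (by exact_mod_cast haj) (hd k)
        have h2 : (j : ℝ) * d k ≤ gridIndex k b * d k :=
          mul_le_mul_of_nonneg_right (by exact_mod_cast hjb.le) (hd k)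
        have h3 : (gridIndex k b : ℝ) * d k ≤ b := gridIndex_mul_le k (ha.trans hab)
        have h4 : a - d k < gridIndex k a * d k := lt_gridIndex_mul k a
        have h5 : (gridIndex k t : ℝ) * d k ≤ t := gridIndex_mul_le k ht.le
        have h6 : t - d k < gridIndex k t * d k := lt_gridIndex_mul k t
        rw [abs_lt] at hat hbt ⊢
        constructor <;> linarith
      have hmem : ((usage R l q₀ sel (d k) j, j * d k) : (S → ℝ) × ℝ) ∈ V := by
        refine hball ?_
        have h1 : dist ((usage R l q₀ sel (d k) j, j * d k) : (S → ℝ) × ℝ)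
            (e k t, gridIndex k t * d k) < r / 2 := by
          rw [Prod.dist_eq]
          refine max_lt ((dist_pi_lt_iff (half_pos hr)).2 fun π' => ?_) hdist
          exact (abs_usage_sub_le (hd k) _ _ π').trans_lt hdist
        have := dist_triangle ((usage R l q₀ sel (d k) j, j * d k) : (S → ℝ) × ℝ)
          (e k t, gridIndex k t * d k) (s t, t)
        rw [Metric.mem_ball]
        linarith
      have h2 := hmax (stateAt R l q₀ (usage R l q₀ sel (d k) j) (j * d k)) ρ hρ
      rw [hj] at h2
      exact absurd hmem (not_lt.2 h2)
    have hlocal : ∀ a b, 0 ≤ a → a ≤ b → |a - t| < r / 4 → |b - t| < r / 4 → s b π = s a π := by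
      intro a b ha hab hat hbt
      refine tendsto_nhds_unique (hs b π (ha.trans hab)) ((hs a π ha).congr' ?_)
      filter_upwards [hev] with k hk
      exact (hnear k hk.1 hk.2 a b ha hab hat hbt).symm
    have htt : |t - t| < r / 4 := by rw [sub_self, abs_zero]; linarith
    filter_upwards [Metric.ball_mem_nhds t (by linarith : 0 < r / 4), lt_mem_nhds ht] with t' h1 h2
    rw [Metric.mem_ball, Real.dist_eq] at h1
    rcases le_total t t' with h3 | h3
    · exact hlocal t t' ht.le h3 htt h1
    · exact (hlocal t' t h2.le h3 h1 htt).symm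

/-- From every state there starts a fluid model solution. -/
theorem IsNetwork.exists_isFluidSolution (hN : IsNetwork S R f l) {q₀ : Fin N → ℝ} (hq₀ : 0 ≤ q₀)
    (T : EReal) : ∃ x : FluidPath S, IsFluidSolution S R f l T x ∧ x.q 0 = q₀ := by
  obtain ⟨s, hlip, hs0, hsum, hnonneg, hmax⟩ := hN.exists_usage hq₀
  have hsnn : ∀ π t, 0 ≤ t → 0 ≤ s t π := fun π t ht => by
    have := (hlip 0 t le_rfl ht π).1
    rwa [hs0] at this
  have hq0 : stateAt R l q₀ (s 0) 0 = q₀ := by simp [stateAt, hs0]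
  have hsac : ∀ π : S, ∀ t, 0 ≤ t → AbsolutelyContinuousOnInterval (fun u => s u π) 0 t := by
    intro π t ht
    refine LipschitzOnWith.absolutelyContinuousOnInterval (K := 1) ?_
    refine LipschitzOnWith.of_le_add_mul 1 fun a ha b hb => ?_
    rw [Set.uIcc_of_le ht] at ha hb
    rw [NNReal.coe_one, one_mul, Real.dist_eq]
    rcases le_total a b with hab | hab
    · have := (hlip a b ha.1 hab π).1
      linarith [abs_nonneg (a - b)]
    · have := (hlip b a hb.1 hab π).2
      linarith [le_abs_self (a - b)]
  have hserv : ∀ n : Fin N, ∀ t, 0 ≤ t → AbsolutelyContinuousOnInterval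
      (fun u => (∑ π : S, s u π • (π : Fin N → ℝ)) n) 0 t := by
    intro n t ht
    simp only [Finset.sum_apply, Pi.smul_apply, smul_eq_mul]
    refine AbsolutelyContinuousOnInterval.sum (g := fun (π : S) u => s u π * (π : Fin N → ℝ) n) _
      fun π _ => ?_
    simp only [mul_comm _ ((π : Fin N → ℝ) n)]
    exact (hsac π t ht).const_mul _
  have hconst : ∀ c t : ℝ, AbsolutelyContinuousOnInterval (fun _ => c) 0 t := fun c t =>
    (LipschitzWith.const c).lipschitzOnWith.absolutelyContinuousOnInterval
  have hlin : ∀ c t : ℝ, AbsolutelyContinuousOnInterval (fun u => u * c) 0 t := fun c t => by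
    simp only [mul_comm _ c]
    exact AbsolutelyContinuousOnInterval.linear c 0 t
  -- Idling is identically zero: the selected schedules were already trimmed at empty queues.
  refine ⟨⟨fun t => stateAt R l q₀ (s t) t, fun t => t • l, fun _ => 0, fun π t => s t π⟩, ?_, hq0⟩
  constructor
  · exact fun t ht => hnonneg t ht.1
  · exact fun t ht => smul_nonneg ht.1 hN.rate_nonneg
  · exact fun t _ => le_rfl
  · exact fun π t ht => hsnn π t ht.1
  · intro t _
    simp only [hq0, sub_zero]
    rfl
  · exact fun t _ => rfl
  · exact fun t ht => hsum t ht.1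
  · exact fun t ht => Finset.sum_nonneg fun π _ =>
      smul_nonneg (hsnn π t ht.1) (hN.sched_nonneg π π.2)
  · exact fun π a ha b _ hab => (hlip a b ha.1 hab π).1
  · exact fun n a _ b _ _ => le_rfl
  · intro n t ht
    simp only [stateAt, Pi.sub_apply, Pi.add_apply, Pi.smul_apply, smul_eq_mul,
      one_sub_transpose_mulVec_apply]
    exact ((hconst _ t).fun_add (hlin _ t)).fun_sub ((hserv n t ht.1).fun_sub
      (AbsolutelyContinuousOnInterval.sum _ fun m _ => (hserv m t ht.1).const_mul _))
  · exact fun n t _ => hlin (l n) t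
  · exact fun n t _ => hconst 0 t
  · exact fun π t ht => hsac π t ht.1
  · intro t _ _ _ n _
    simp
  · intro t ht _ _ π hπ
    have hev : (fun u => s u π) =ᶠ[𝓝 t] fun _ => s t π := hmax t ht π hπ
    exact hev.deriv_eq.trans (deriv_const t _)

/-- Existence of a solution from q₀ is what gives the forward direction content. -/
theorem IsNetwork.isInvariantState_iff (h : IsNetwork S R f l) {T : EReal} (hT : 0 < T)
    {q₀ : Fin N → ℝ} (hq₀ : 0 ≤ q₀) :
    IsInvariantState S R f l T q₀ ↔ q₀ = liftingMap S R f l q₀ := by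
  constructor
  · intro hinv
    obtain ⟨x, hx, rfl⟩ := h.exists_isFluidSolution hq₀ T
    exact (h.eq_liftingMap_iff_isBalanced hq₀).2
      (hx.isBalanced_of_const h hT fun t ht => hinv x hx rfl t ht)
  · rintro hfix x hx rfl t ht
    exact hx.eq_of_isBalanced h hT hfix ht

end SwitchedNetwork

end

theorem theorem6p1 {N : ℕ} (S : Finset (Fin N → ℝ)) (R : Matrix (Fin N) (Fin N) ℝ)
    (f : ℝ → ℝ) (l : Fin N → ℝ)
    (hS : ∀ π ∈ S, 0 ≤ π)
    (hserved : ∀ n, ∃ π ∈ S, 0 < π n)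
    (hmono : IsMonotoneSchedules S)
    (hR : IsAcyclicRouting R)
    (hf : IsWeightFunction S R f)
    (hl : 0 ≤ l)
    (hadm : through R l ∈ admissibleRegion S) :
    -- the lifting map is well defined
    (∀ q : Fin N → ℝ, 0 ≤ q →
      IsOptimizer S R f l q (liftingMap S R f l q) ∧
        ∀ r, IsOptimizer S R f l q r → r = liftingMap S R f l q) ∧
    -- (i)
    (∀ K : ℝ, IsCompact {q : Fin N → ℝ | 0 ≤ q ∧ lyapunov f q ≤ K}) ∧
    (∀ T : EReal, 0 < T → ∀ x : FluidPath S, IsFluidSolution S R f l T x →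
      ∀ t ∈ horizon T, lyapunov f (x.q t) ≤ lyapunov f (x.q 0)) ∧
    -- (ii)
    ContinuousOn (liftingMap S R f l) {q | 0 ≤ q} ∧
    -- (iii)
    (∀ q : Fin N → ℝ, 0 ≤ q → q = liftingMap S R f l q →
      ∀ κ : ℝ, 0 < κ → liftingMap S R f l (κ • q) = κ • liftingMap S R f l q) ∧
    -- (iv)
    (∀ T : EReal, 0 < T → ∀ q₀ : Fin N → ℝ, 0 ≤ q₀ →
      (IsInvariantState S R f l T q₀ ↔ q₀ = liftingMap S R f l q₀)) ∧
    -- (v)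
    (∀ ε : ℝ, 0 < ε → ∃ H : ℝ, ∀ T : EReal, 0 < T → ∀ x : FluidPath S,
      IsFluidSolution S R f l T x → ‖x.q 0‖ ≤ 1 →
        ∀ t ∈ horizon T, H ≤ t → ‖x.q t - liftingMap S R f l (x.q t)‖ < ε) := by
  have h : IsNetwork S R f l := ⟨hS, hserved, hmono, hR, hf, hl, hadm⟩
  refine ⟨fun q hq => ⟨h.liftingMap_spec hq, fun r hr => h.eq_liftingMap hq hr⟩, fun K => ?_,
    fun T hT x hx t ht => ?_, h.continuousOn_liftingMap,
    fun q hq hfix κ hκ => h.liftingMap_smul hq hfix hκ.le,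
    fun T hT q₀ hq₀ => h.isInvariantState_iff hT hq₀, fun ε hε => h.exists_uniform_time hε⟩
  · convert hf.isCompact_sublevel (N := N) K using 1
    ext q
    exact and_congr_right fun hq => by rw [lyapunov_eq_energy hq]
  · rw [lyapunov_eq_energy (hx.q_nonneg t ht),
      lyapunov_eq_energy (hx.q_nonneg 0 (zero_mem_horizon hT))]
    exact hx.energy_le h le_rfl ht.1 ht
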